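/- Let $p$ be a prime, $r\ge 1$, $q=p^r\neq 2$, and let $n\geq 4$ be an integer. For $s$ with $1\le s<n$, $\gcd(s,n)=1$, and $\delta\in\mathbb F_{q^n}^*$ with $N_{q^n/q}(\delta)=\delta^{(q^n-1)/(q-1)}\neq 1$, the point set $$L_{s,\delta}=\{\langle (x,\,x^{q^s}+\delta x^{q^{n-s}})\rangle_{\mathbb F_{q^n}} : x\in\mathbb F_{q^n}^*\}\subseteq \mathrm{PG}(1,q^n)$$ is called a Lunardon–Polverino (scattered) linear set. Two such sets $L, L'$ are equivalent if $\psi(L)=L'$ for some $\psi\in\mathrm{P\Gamma L}(2,q^n)$, i.e. for some $\psi$ induced by a bijective semilinear map of $\mathbb F_{q^n}^2$. Let $\Lambda(n,q)$ be the number of equivalence classes of Lunardon–Polverino linear sets in $\mathrm{PG}(1,q^n)$. For $m\ge1$ let $F(m)$ be the set of elements of $\mathbb F_{p^m}$ that lie in no proper subfield of $\mathbb F_{p^m}$, and let $K(m)=\{x\in F(m): x^{p^k+1}=1 \text{ for some } 0\le k<m\}$. Let $\varphi$ be Euler's totient function. Then, if $n$ is odd, $$\Lambda(n,q)=\left(\sum_{r'\mid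 r,\ r'>1}\frac{|F(r')|+|K(r')|}{2r'}+\epsilon\right)\frac{\varphi(n)}{2},$$ and if $n$ is even, $$\Lambda(n,q)=\left(\sum_{r'\mid r,\ r'>1}\frac{|F(r')|+|K(r')|}{2r'}+\sum_{r'\mid 2r,\ r'\nmid r}\frac{|F(r')|-|K(r')|}{2r'}+\epsilon\right)\frac{\varphi(n)}{2},$$ where $$\epsilon=\begin{cases}\frac{p-1}{2}, & p\neq2,\ 2\nmid n;\\ \frac{p-3}{2}, & p\neq 2,\ 2\mid n;\\ 0, & p=2.\end{cases}$$ -/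

import Mathlib

open scoped LinearAlgebra.Projectivization

/-- The linear set `L_U` of the projective line `PG(1, K)` defined by an `F`-subspace `U` of `K²`:
the set of all points `⟨u⟩_K` with `u` a nonzero vector of `U`. -/
def linearSet {F K : Type*} [Field F] [Field K] [Algebra F K] (U : Submodule F (K × K)) :
    Set (ℙ K (K × K)) :=
  {P | ∃ (u : K × K) (hu : u ≠ 0), u ∈ U ∧ P = Projectivization.mk K u hu}

/-- The `F`-linear map `x ↦ x ^ (q ^ i)` on `K`, where `q = |F|`. -/
noncomputable def powMap (F K : Type*) [Field F] [Finite F] [Field K] [Algebra F K] (i : ℕ) :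
    K →ₗ[F] K :=
  letI := Fintype.ofFinite F
  ((FiniteField.frobeniusAlgHom F K) ^ i).toLinearMap

theorem powMap_apply (F K : Type*) [Field F] [Finite F] [Field K] [Algebra F K] (i : ℕ) (x : K) :
    powMap F K i x = x ^ (Nat.card F ^ i) := by
  let _ := Fintype.ofFinite F
  simp only [powMap, AlgHom.toLinearMap_apply, AlgHom.coe_pow, FiniteField.coe_frobeniusAlgHom,
    pow_iterate, Nat.card_eq_fintype_card]

/-- The map `x ↦ x ^ (q ^ s) + δ * x ^ (q ^ (n - s))` on `K`, where `q = |F|` and `n = [K : F]`. -/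
noncomputable def lpMap (F K : Type*) [Field F] [Finite F] [Field K] [Algebra F K]
    (s : ℕ) (δ : K) : K →ₗ[F] K :=
  powMap F K s + δ • powMap F K (Module.finrank F K - s)

theorem lpMap_apply (F K : Type*) [Field F] [Finite F] [Field K] [Algebra F K]
    (s : ℕ) (δ x : K) :
    lpMap F K s δ x = x ^ (Nat.card F ^ s) + δ * x ^ (Nat.card F ^ (Module.finrank F K - s)) := by
  simp [lpMap, powMap_apply]

/-- `L` is a Lunardon-Polverino linear set of `PG(1, K)`, with `q = |F|` and `n = [K : F]`:
`L = {⟨(x, x ^ (q ^ s) + δ * x ^ (q ^ (n - s)))⟩ : x ∈ K, x ≠ 0}` for some `s` with `1 ≤ s < n`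
coprime to `n` and some nonzero `δ` whose norm over `F` is not `1`. -/
def IsLunardonPolverino (F K : Type*) [Field F] [Finite F] [Field K] [Algebra F K]
    (L : Set (ℙ K (K × K))) : Prop :=
  ∃ (s : ℕ) (δ : K), 1 ≤ s ∧ s < Module.finrank F K ∧ Nat.Coprime s (Module.finrank F K) ∧
    δ ≠ 0 ∧ Algebra.norm F δ ≠ 1 ∧ L = linearSet (lpMap F K s δ).graph

/-- The group `PΓL(2, K)`: all permutations of `PG(1, K)` induced by bijective semilinear maps
of `K²`. -/
def PGammaL (K : Type*) [Field K] : Subgroup (Equiv.Perm (ℙ K (K × K))) where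
  carrier := {g | ∃ (τ : K ≃+* K) (φ : (K × K) →ₛₗ[(τ : K →+* K)] (K × K))
    (hφ : Function.Bijective φ), ∀ P, g P = Projectivization.map φ hφ.injective P}
  one_mem' := by
    refine ⟨RingEquiv.refl K, ⟨⟨id, fun _ _ => rfl⟩, fun _ _ => rfl⟩, Function.bijective_id, ?_⟩
    intro P
    induction P using Projectivization.ind with
    | h v hv => rfl
  mul_mem' := by
    rintro g h ⟨τ, φ, hφ, hg⟩ ⟨τ', φ', hφ', hh⟩
    refine ⟨τ'.trans τ, ⟨⟨fun v => φ (φ' v), fun v w => by simp⟩, fun c v => ?_⟩,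
      hφ.comp hφ', ?_⟩
    · change φ (φ' (c • v)) = τ (τ' c) • φ (φ' v)
      rw [φ'.map_smulₛₗ, φ.map_smulₛₗ]
      rfl
    · intro P
      induction P using Projectivization.ind with
      | h v hv =>
        rw [Equiv.Perm.mul_apply, hh, Projectivization.map_mk, hg, Projectivization.map_mk]
        rfl
  inv_mem' := by
    rintro g ⟨τ, φ, hφ, hg⟩
    let e := Equiv.ofBijective φ hφ
    have he : ∀ v, φ (e.symm v) = v := fun v => e.apply_symm_apply v
    have hb : Function.Bijective (e.symm : K × K → K × K) := e.symm.bijective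
    refine ⟨τ.symm, ⟨⟨e.symm, fun v w => hφ.injective ?_⟩, fun c v => hφ.injective ?_⟩, hb, ?_⟩
    · rw [he, map_add, he, he]
    · change φ (e.symm (c • v)) = φ (τ.symm c • e.symm v)
      rw [he, φ.map_smulₛₗ, he]
      simp
    · intro P
      rw [Equiv.Perm.inv_eq_iff_eq, hg]
      induction P using Projectivization.ind with
      | h v hv =>
        rw [Projectivization.map_mk, Projectivization.map_mk]
        congr 1
        exact (he v).symm

/-- `PΓL`-equivalence of Lunardon-Polverino linear sets: some `g ∈ PΓL(2, K)` maps one onto the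
other. -/
def lpSetoid (F K : Type*) [Field F] [Finite F] [Field K] [Algebra F K] :
    Setoid {L : Set (ℙ K (K × K)) // IsLunardonPolverino F K L} where
  r L M := ∃ g ∈ PGammaL K, g '' L.1 = M.1
  iseqv :=
    { refl := fun L => ⟨1, one_mem _, by simp⟩
      symm := by
        rintro L M ⟨g, hg, h⟩
        refine ⟨g⁻¹, inv_mem hg, ?_⟩
        rw [← h, ← Set.image_comp]
        convert Set.image_id _
        ext x
        simp
      trans := by
        rintro L M N ⟨g, hg, h⟩ ⟨g', hg', h'⟩
        refine ⟨g' * g, mul_mem hg' hg, ?_⟩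
        rw [← h', ← h, ← Set.image_comp]
        rfl }

/-- `Λ(n, q)`, for `q = |F|` and `n = [K : F]`: the number of `PΓL`-equivalence classes of
Lunardon-Polverino linear sets of `PG(1, K)`. -/
noncomputable def numLP (F K : Type*) [Field F] [Finite F] [Field K] [Algebra F K] : ℕ :=
  Nat.card (Quotient (lpSetoid F K))

/-- `F(m)`: the elements of `𝔽_{p^m}` that lie in no proper subfield. -/
def setF (p : ℕ) [Fact p.Prime] (m : ℕ) : Set (GaloisField p m) :=
  {x | ∀ E : Subfield (GaloisField p m), x ∈ E → E = ⊤}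

/-- `K(m)`: the elements `x` of `F(m)` with `x ^ (p ^ k + 1) = 1` for some `0 ≤ k < m`. -/
def setK (p : ℕ) [Fact p.Prime] (m : ℕ) : Set (GaloisField p m) :=
  {x | x ∈ setF p m ∧ ∃ k < m, x ^ (p ^ k + 1) = 1}

/-- The correction term `ε`. -/
def epsLP (p n : ℕ) : ℚ :=
  if p = 2 then 0 else if Odd n then ((p : ℚ) - 1) / 2 else ((p : ℚ) - 3) / 2

/-! Write σ for x ↦ x^(q^s) and f = σ + δσ⁻¹. The linear set of the graph of f is determined by the
value set {f(x)/x : x ≠ 0}, and the question is how much this set knows about f. Expand an F-linear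
map of K as ∑ c_γ γ over the Galois group and let D be its Dickson matrix. With weights w(α) = q^i,
the polynomial det(diag(X^w(α)) + D) is monic of degree (q^n − 1)/(q − 1), vanishes at −z for each
value z, and has the principal minors of D as coefficients, because sums of distinct powers q^i
determine their summands. Since N(δ) ≠ 1, f is scattered and has at least that many values. Hence a
map with the value set of f has the same principal minors (`det_dickson_submatrix_eq`), and f shares
its value set with its adjoint (`valueSet_eq_of_dickson_transpose`).

The minors on 1, σ, …, σ^k then show that a map with the value set of σ + ησ⁻¹ is aσ + bσ⁻¹ with
aσ(b) = σ(η) and N(a) + N(b) = 1 + N(η), so that N(a) = 1 or N(b) = 1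
(`coeff_of_valueSet_eq_binomial`). An equivalence carries one graph to the graph of such a map;
comparing coefficients of automorphisms (`MapsGraph`) forces t = ±s mod n and relates ν(δ) to ν(η)
by a field automorphism, possibly with inversion, where ν is the norm to the subfield of q^gcd(2,n)
elements. Conversely, field automorphisms, diagonal maps and the adjoint realise all these
relations. So a class is a pair: s up to sign, and ν(δ) up to automorphisms and inversion
(`numLP_eq_card_parameterSetoid`).

The first component gives φ(n)/2. For the second, an element of degree d over the prime field has a
class of size d if its inverse is conjugate to it and 2d otherwise, so it counts with weight 2/(2d)
or 1/(2d); this produces (|F(d)| + |K(d)|)/(2d). For n odd, ν(δ) runs over all elements of 𝔽_q other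
than 0 and 1. For n even it runs over the nonzero y in 𝔽_{q²} with y^(q+1) ≠ 1, and among elements
whose degree does not divide r this condition removes exactly those of K(d). Degree one contributes
ε. -/

/-! ### Determinants of cyclically tridiagonal matrices -/

namespace Matrix

theorem det_add_single {m R : Type*} [Fintype m] [DecidableEq m] [CommRing R]
    (M : Matrix m m R) (i j : m) (x : R) :
    (M + single i j x).det = M.det + x * M.adjugate j i := by
  have h : M + single i j x = M.updateRow i (M i + x • Pi.single j 1) := by
    ext a b
    by_cases ha : a = i
    · subst ha
      simp [single_apply, Pi.single_apply, eq_comm]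
    · simp [ha, Ne.symm ha]
  rw [h, det_updateRow_add, updateRow_eq_self, det_updateRow_smul, adjugate_apply]

/-- The determinant is affine in `x` and in `y` separately. The mixed coefficient `d` may stay
anonymous: only its independence of `x` and `y` is needed. -/
theorem det_add_single_add_single {m R : Type*} [Fintype m] [DecidableEq m] [CommRing R]
    (M : Matrix m m R) (i j i' j' : m) : ∃ d : R, ∀ x y : R,
    (M + single i j x + single i' j' y).det =
      M.det + x * M.adjugate j i + y * M.adjugate j' i' + x * y * d := by
  refine ⟨(M + single i j 1).adjugate j' i' - M.adjugate j' i', fun x y => ?_⟩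
  have h1 : ∀ z : R, (M + single i' j' y + single i j z).det
      = (M + single i' j' y).det + z * (M + single i' j' y).adjugate j i :=
    fun z => det_add_single _ _ _ _
  have h2 := h1 1
  rw [add_right_comm M, det_add_single, det_add_single] at h2
  rw [add_right_comm M, h1, det_add_single]
  rw [det_add_single] at h2
  linear_combination (-x) * h2

/-- Deleting the first row and the last column leaves an upper triangular matrix whose diagonal is
the subdiagonal of `T`. -/
theorem adjugate_last_zero_of_tridiagonal {k : ℕ} {R : Type*} [CommRing R]
    (T : Matrix (Fin (k + 1)) (Fin (k + 1)) R)
    (hT : ∀ i j : Fin (k + 1), (j : ℕ) + 1 < i → T i j = 0) :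
    T.adjugate (Fin.last k) 0 = (-1) ^ k * ∏ i : Fin k, T i.succ i.castSucc := by
  rw [adjugate_fin_succ_eq_det_submatrix, det_of_isUpperTriangular]
  · simp
  · intro i j hij
    have hij : (j : ℕ) < i := hij
    simp only [submatrix_apply, Fin.succAbove_zero, Fin.succAbove_last]
    exact hT _ _ (by simpa using hij)

theorem adjugate_zero_last_of_tridiagonal {k : ℕ} {R : Type*} [CommRing R]
    (T : Matrix (Fin (k + 1)) (Fin (k + 1)) R)
    (hT : ∀ i j : Fin (k + 1), (i : ℕ) + 1 < j → T i j = 0) :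
    T.adjugate 0 (Fin.last k) = (-1) ^ k * ∏ i : Fin k, T i.castSucc i.succ := by
  have := adjugate_last_zero_of_tridiagonal Tᵀ (fun i j h => hT j i h)
  rw [← adjugate_transpose] at this
  simpa using this

/-- A square matrix all of whose nonzero entries lie next to the diagonal or in the two corners
away from it. -/
def IsCyclicTridiagonal {k : ℕ} {R : Type*} [Zero R]
    (H : Matrix (Fin (k + 1)) (Fin (k + 1)) R) : Prop :=
  ∀ i j : Fin (k + 1), H i j ≠ 0 → (i : ℕ) + 1 = j ∨ (j : ℕ) + 1 = i ∨
    (i = 0 ∧ j = Fin.last k) ∨ (i = Fin.last k ∧ j = 0)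

/-- The corners are perturbations of the tridiagonal part `T` of `G`, and their cofactors are the
products along the off-diagonals. The constants are fixed before `H`, so two matrices sharing these
off-diagonals can be compared. With `2 ≤ k` the corners do not lie next to the diagonal. -/
theorem exists_det_of_isCyclicTridiagonal {k : ℕ} (hk : 2 ≤ k) {R : Type*} [CommRing R]
    (G : Matrix (Fin (k + 1)) (Fin (k + 1)) R) :
    ∃ a d : R, ∀ H : Matrix (Fin (k + 1)) (Fin (k + 1)) R, H.IsCyclicTridiagonal →
      (∀ i : Fin k, H i.castSucc i.succ = G i.castSucc i.succ) →
      (∀ i : Fin k, H i.succ i.castSucc = G i.succ i.castSucc) →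
      H.det = a + H 0 (Fin.last k) * H (Fin.last k) 0 * d + (-1) ^ k *
        (H 0 (Fin.last k) * ∏ i : Fin k, H i.succ i.castSucc +
          H (Fin.last k) 0 * ∏ i : Fin k, H i.castSucc i.succ) := by
  let T : Matrix (Fin (k + 1)) (Fin (k + 1)) R :=
    of fun i j => if (i : ℕ) + 1 = j ∨ (j : ℕ) + 1 = i then G i j else 0
  obtain ⟨d, hd⟩ := det_add_single_add_single T 0 (Fin.last k) (Fin.last k) 0
  refine ⟨T.det, d, fun H hH hsup hsub => ?_⟩
  have key : H = T + single 0 (Fin.last k) (H 0 (Fin.last k)) +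
      single (Fin.last k) 0 (H (Fin.last k) 0) := by
    ext i j
    by_cases h1 : (i : ℕ) + 1 = j
    · have hi : (i : ℕ) < k := by omega
      have e1 : i = (⟨i, hi⟩ : Fin k).castSucc := rfl
      have e2 : j = (⟨i, hi⟩ : Fin k).succ := Fin.ext h1.symm
      have n1 : ¬ (0 = i ∧ Fin.last k = j) := by
        rintro ⟨rfl, rfl⟩; simp at h1; omega
      have n2 : ¬ (Fin.last k = i ∧ 0 = j) := by
        rintro ⟨rfl, rfl⟩; simp at h1
      simp only [add_apply, single_apply, n1, n2, T, of_apply, h1, true_or, if_true, if_false,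
        add_zero]
      rw [e1, e2, hsup]
    by_cases h2 : (j : ℕ) + 1 = i
    · have hi : (j : ℕ) < k := by omega
      have e1 : j = (⟨j, hi⟩ : Fin k).castSucc := rfl
      have e2 : i = (⟨j, hi⟩ : Fin k).succ := Fin.ext h2.symm
      have n1 : ¬ (0 = i ∧ Fin.last k = j) := by
        rintro ⟨rfl, rfl⟩; simp at h2
      have n2 : ¬ (Fin.last k = i ∧ 0 = j) := by
        rintro ⟨rfl, rfl⟩; simp at h2; omega
      simp only [add_apply, single_apply, n1, n2, T, of_apply, h2, or_true, if_true, if_false,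
        add_zero]
      rw [e1, e2, hsub]
    have hl : (0 : Fin (k + 1)) ≠ Fin.last k := by
      intro h; have := congrArg Fin.val h; simp at this; omega
    by_cases h3 : i = 0 ∧ j = Fin.last k
    · obtain ⟨rfl, rfl⟩ := h3
      simp [T, hl]
      intro h; omega
    by_cases h4 : i = Fin.last k ∧ j = 0
    · obtain ⟨rfl, rfl⟩ := h4
      simp [T, hl]
      intro h; omega
    have h0 : H i j = 0 := by
      by_contra h
      rcases hH i j h with h | h | h | h <;> contradiction
    rw [h0]
    simp [T, h1, h2, single_apply]
    rw [if_neg (by rintro ⟨rfl, rfl⟩; simp at h3), if_neg (by rintro ⟨rfl, rfl⟩; simp at h4),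
      add_zero]
  have hT0 : ∀ i j : Fin (k + 1), ((j : ℕ) + 1 < i ∨ (i : ℕ) + 1 < j) → T i j = 0 := by
    intro i j h
    simp only [T, of_apply]
    rw [if_neg (by omega)]
  rw [show H.det = _ from congrArg det key, hd,
    adjugate_last_zero_of_tridiagonal T (fun i j h => hT0 i j (Or.inl h)),
    adjugate_zero_last_of_tridiagonal T (fun i j h => hT0 i j (Or.inr h))]
  have p1 : ∏ i : Fin k, T i.succ i.castSucc = ∏ i : Fin k, H i.succ i.castSucc :=
    Finset.prod_congr rfl fun i _ => by simp [T, hsub]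
  have p2 : ∏ i : Fin k, T i.castSucc i.succ = ∏ i : Fin k, H i.castSucc i.succ :=
    Finset.prod_congr rfl fun i _ => by simp [T, hsup]
  rw [p1, p2]
  ring

/-- Two cyclically tridiagonal matrices with the same determinant and the same principal minors of
order two have the same sum of products over the two directed Hamiltonian cycles. -/
theorem IsCyclicTridiagonal.cycle_sum_eq {k : ℕ} (hk : 2 ≤ k) {K : Type*} [Field K]
    {G H : Matrix (Fin (k + 1)) (Fin (k + 1)) K} (hG : G.IsCyclicTridiagonal)
    (hH : H.IsCyclicTridiagonal)
    (hG0 : ∀ i : Fin k, G i.castSucc i.succ ≠ 0) (hH0 : ∀ i : Fin k, H i.castSucc i.succ ≠ 0)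
    (h2 : ∀ i j, H i j * H j i = G i j * G j i) (hdet : H.det = G.det) :
    H 0 (Fin.last k) * ∏ i : Fin k, H i.succ i.castSucc +
        H (Fin.last k) 0 * ∏ i : Fin k, H i.castSucc i.succ =
      G 0 (Fin.last k) * ∏ i : Fin k, G i.succ i.castSucc +
        G (Fin.last k) 0 * ∏ i : Fin k, G i.castSucc i.succ := by
  let r : ℕ → K := fun m => if h : m < k then
    G (⟨m, h⟩ : Fin k).castSucc (⟨m, h⟩ : Fin k).succ /
      H (⟨m, h⟩ : Fin k).castSucc (⟨m, h⟩ : Fin k).succ else 1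
  have hr : ∀ i : Fin k, r i = G i.castSucc i.succ / H i.castSucc i.succ := fun i => by
    simp only [r, i.isLt, dif_pos]
  have hr0 : ∀ m, r m ≠ 0 := fun m => by
    by_cases h : m < k
    · simp only [r, h, dif_pos]
      exact div_ne_zero (hG0 _) (hH0 _)
    · simp [r, h]
  let d : ℕ → K := fun i => ∏ m ∈ Finset.range i, r m
  have hd0 : ∀ i, d i ≠ 0 := fun i => Finset.prod_ne_zero_iff.2 fun m _ => hr0 m
  have hds : ∀ i, d (i + 1) = d i * r i := fun i => Finset.prod_range_succ _ _
  -- Conjugation by a diagonal matrix keeps the determinant and all products `H i j * H j i`. The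
  -- running product `d` is chosen so that the superdiagonal becomes that of `G`; the subdiagonals
  -- then agree as well.
  let H' : Matrix (Fin (k + 1)) (Fin (k + 1)) K :=
    diagonal (fun i : Fin (k + 1) => (d i)⁻¹) * H * diagonal (fun i : Fin (k + 1) => d i)
  have hH'a : ∀ i j, H' i j = (d i)⁻¹ * H i j * d j := fun i j => by
    simp [H', mul_diagonal, diagonal_mul]
  have hdet' : H'.det = H.det := by
    simp only [H', det_mul, det_diagonal]
    rw [mul_right_comm, ← Finset.prod_mul_distrib]
    simp [hd0]
  have hH' : H'.IsCyclicTridiagonal := fun i j h => hH i j fun h0 => h (by rw [hH'a, h0]; simp)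
  have hsup : ∀ i : Fin k, H' i.castSucc i.succ = G i.castSucc i.succ := fun i => by
    rw [hH'a]
    simp only [Fin.val_castSucc, Fin.val_succ, hds, hr]
    have := hd0 i
    have := hH0 i
    field_simp
  have h2' : ∀ i j, H' i j * H' j i = G i j * G j i := fun i j => by
    rw [hH'a, hH'a, ← h2]
    have := hd0 i
    have := hd0 j
    field_simp
  have hsub : ∀ i : Fin k, H' i.succ i.castSucc = G i.succ i.castSucc := fun i => by
    have := h2' i.castSucc i.succ
    rw [hsup] at this
    exact mul_left_cancel₀ (hG0 i) this
  obtain ⟨a, c, hac⟩ := exists_det_of_isCyclicTridiagonal hk G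
  have e1 := hac H' hH' hsup hsub
  have e2 := hac G hG (fun _ => rfl) (fun _ => rfl)
  rw [hdet', hdet, e2, h2'] at e1
  have e3 := mul_left_cancel₀ (pow_ne_zero k (neg_ne_zero.2 one_ne_zero)) (add_left_cancel e1)
  rw [e3]
  -- The corners are scaled by `d k` and its inverse, and the off-diagonal products by the opposite
  -- factors, so the cycle sum of `H'` is that of `H`.
  have q1 : ∏ i : Fin k, H' i.castSucc i.succ = (∏ i : Fin k, H i.castSucc i.succ) * d k := by
    simp only [d]
    rw [← Fin.prod_univ_eq_prod_range, ← Finset.prod_mul_distrib]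
    refine Finset.prod_congr rfl fun i _ => ?_
    rw [hsup, hr]
    have := hH0 i
    field_simp
  have q2 : ∏ i : Fin k, H i.succ i.castSucc = (∏ i : Fin k, H' i.succ i.castSucc) * d k := by
    simp only [d]
    rw [← Fin.prod_univ_eq_prod_range, ← Finset.prod_mul_distrib]
    refine Finset.prod_congr rfl fun i _ => ?_
    rw [hr, hH'a]
    simp only [Fin.val_castSucc, Fin.val_succ, hds, hr]
    have := hH0 i
    have := hG0 i
    have := hd0 i
    field_simp
  rw [q1, q2, hH'a, hH'a]
  have := hd0 k
  have hd00 : d 0 = 1 := by simp [d]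
  simp only [Fin.val_zero, Fin.val_last, hd00]
  field_simp

/-! ### The polynomial `det (diag (X ^ w i) + D)` and principal minors -/

/-- The matrix `D` with its rows in `s` replaced by those of the identity matrix. -/
def replaceRows {m R : Type*} [DecidableEq m] [Zero R] [One R] (s : Finset m)
    (D : Matrix m m R) : Matrix m m R :=
  of fun i j => if i ∈ s then (1 : Matrix m m R) i j else D i j

open Polynomial in
/-- The polynomial `det (diag (X ^ w i) + D)`. -/
noncomputable def weightedCharpoly {m R : Type*} [Fintype m] [DecidableEq m] [CommRing R]
    (w : m → ℕ) (D : Matrix m m R) : R[X] :=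
  (diagonal (fun i => (X : R[X]) ^ w i) + D.map C).det

-- Multilinear expansion in the rows: `s` is the set of rows taken from the diagonal summand.
open Polynomial in
theorem weightedCharpoly_eq_sum {m R : Type*} [Fintype m] [DecidableEq m] [CommRing R]
    (w : m → ℕ) (D : Matrix m m R) :
    weightedCharpoly w D = ∑ s : Finset m,
      C (replaceRows s D).det * X ^ (∑ i ∈ s, w i) := by
  have h := (detRowAlternating (n := m) (R := R[X])).toMultilinearMap.map_add_univ
    (diagonal (fun i => (X : R[X]) ^ w i)) (D.map C)
  rw [weightedCharpoly]
  refine h.trans (Finset.sum_congr rfl fun s _ => ?_)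
  have e : s.piecewise (diagonal (fun i => (X : R[X]) ^ w i) : m → m → R[X]) (D.map C) =
      s.piecewise (fun i => (X : R[X]) ^ w i • ((replaceRows s D).map C : m → m → R[X]) i)
        ((replaceRows s D).map C : m → m → R[X]) := by
    refine Finset.piecewise_congr s (fun i hi => ?_) fun i hi => ?_
    · funext j
      by_cases hij : i = j
      · subst hij
        simp [replaceRows, hi]
      · simp [replaceRows, hi, hij]
    · funext j
      simp [replaceRows, hi]
  have h2 := (detRowAlternating (n := m) (R := R[X])).toMultilinearMap.map_piecewise_smul
    (fun i => (X : R[X]) ^ w i) ((replaceRows s D).map C) s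
  refine (congrArg _ e).trans (h2.trans ?_)
  rw [Finset.prod_pow_eq_pow_sum, smul_eq_mul, mul_comm]
  congr 1
  exact ((C : R →+* R[X]).map_det _).symm

-- Distinct subset sums of the weights keep the summands of the expansion in distinct monomials.
open Polynomial in
theorem coeff_weightedCharpoly {m R : Type*} [Fintype m] [DecidableEq m] [CommRing R]
    {w : m → ℕ} (hw : Function.Injective fun s : Finset m => ∑ i ∈ s, w i) (D : Matrix m m R)
    (s : Finset m) : (weightedCharpoly w D).coeff (∑ i ∈ s, w i) =
      (replaceRows s D).det := by
  rw [weightedCharpoly_eq_sum, finsetSum_coeff, Finset.sum_eq_single s]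
  · simp
  · intro t _ hts
    rw [coeff_C_mul_X_pow, if_neg fun h => hts (hw h).symm]
  · simp

open Polynomial in
theorem degree_weightedCharpoly_sub_lt {m R : Type*} [Fintype m] [DecidableEq m] [CommRing R]
    [Nontrivial R] {w : m → ℕ} (hw : Function.Injective fun s : Finset m => ∑ i ∈ s, w i)
    (D : Matrix m m R) :
    (weightedCharpoly w D - X ^ (∑ i, w i)).degree < ((∑ i, w i : ℕ) : WithBot ℕ) := by
  have h : weightedCharpoly w D - X ^ (∑ i, w i) = ∑ s ∈ Finset.univ.erase (Finset.univ : Finset m),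
      C (replaceRows s D).det * X ^ (∑ i ∈ s, w i) := by
    rw [weightedCharpoly_eq_sum, ← Finset.add_sum_erase _ _ (Finset.mem_univ Finset.univ)]
    have : replaceRows (Finset.univ : Finset m) D = 1 := by
      ext i j; simp [replaceRows]
    rw [this]
    simp
  rw [h]
  refine (degree_sum_le _ _).trans_lt ((Finset.sup_lt_iff (WithBot.bot_lt_coe _)).2 ?_)
  intro s hs
  refine (degree_C_mul_X_pow_le _ _).trans_lt (WithBot.coe_lt_coe.2 ?_)
  refine lt_of_le_of_ne (Finset.sum_le_sum_of_subset (Finset.subset_univ s)) fun he => ?_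
  exact (Finset.mem_erase.1 hs).1 (hw he)

open Polynomial in
theorem eval_weightedCharpoly {m R : Type*} [Fintype m] [DecidableEq m] [CommRing R]
    (w : m → ℕ) (D : Matrix m m R) (z : R) :
    (weightedCharpoly w D).eval z = (diagonal (fun i => z ^ w i) + D).det := by
  rw [weightedCharpoly, ← coe_evalRingHom, RingHom.map_det]
  congr 1
  ext i j
  by_cases h : i = j
  · subst h
    simp
  · simp [h]

open Polynomial in
theorem weightedCharpoly_transpose {m R : Type*} [Fintype m] [DecidableEq m] [CommRing R]
    (w : m → ℕ) (D : Matrix m m R) : weightedCharpoly w Dᵀ = weightedCharpoly w D := by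
  rw [weightedCharpoly, weightedCharpoly, ← det_transpose, transpose_add, diagonal_transpose]
  rfl

/-- The identity rows make the matrix block triangular, so the coefficients of `weightedCharpoly`
are principal minors. -/
theorem det_replaceRows_compl_map {m R : Type*} [Fintype m] [DecidableEq m] [CommRing R]
    (D : Matrix m m R) {ι : Type*} [Fintype ι] [DecidableEq ι] (e : ι ↪ m) :
    (replaceRows (Finset.univ.map e)ᶜ D).det = (D.submatrix e e).det := by
  classical
  set s := Finset.univ.map e with hs
  set M := replaceRows sᶜ D with hM
  have hrow : ∀ i ∈ s, M i = D i := fun i hi => by ext j; simp [hM, replaceRows, hi]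
  have hrow' : ∀ i, i ∉ s → M i = (1 : Matrix m m R) i := fun i hi => by ext j; simp [hM, replaceRows, hi]
  rw [twoBlockTriangular_det M (· ∈ s)]
  · have h1 : toSquareBlockProp M (fun i => ¬ i ∈ s) = 1 := by
      ext ⟨i, hi⟩ ⟨j, hj⟩
      have := congrFun (hrow' i hi) j
      simp only [toSquareBlockProp_def, of_apply]
      rw [this]
      simp [one_apply, Subtype.ext_iff]
    rw [h1, det_one, mul_one]
    let f : ι ≃ {i // i ∈ s} := Equiv.ofBijective
      (fun i => ⟨e i, Finset.mem_map_of_mem e (Finset.mem_univ i)⟩) ⟨fun i j h => by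
        simpa using h, fun ⟨i, hi⟩ => by
        obtain ⟨a, -, rfl⟩ := Finset.mem_map.1 hi
        exact ⟨a, rfl⟩⟩
    have hf := det_submatrix_equiv_self f (toSquareBlockProp M (· ∈ s))
    refine Eq.trans ?_ (hf.symm.trans (congrArg det ?_))
    · congr!
    ext i j
    exact congrFun (hrow (e i) (Finset.mem_map_of_mem e (Finset.mem_univ i))) (e j)
  · intro i hi j hj
    rw [congrFun (hrow' i hi) j, one_apply_ne]
    rintro rfl
    exact hi hj

theorem det_submatrix_eq_of_weightedCharpoly_eq {m R : Type*} [Fintype m] [DecidableEq m]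
    [CommRing R] {w : m → ℕ} (hw : Function.Injective fun s : Finset m => ∑ i ∈ s, w i)
    {D E : Matrix m m R} (h : weightedCharpoly w D = weightedCharpoly w E)
    {ι : Type*} [Fintype ι] [DecidableEq ι] (e : ι ↪ m) :
    (D.submatrix e e).det = (E.submatrix e e).det := by
  rw [← det_replaceRows_compl_map, ← det_replaceRows_compl_map, ← coeff_weightedCharpoly hw,
    ← coeff_weightedCharpoly hw, h]

end Matrix

/-! ### Linear maps as combinations of automorphisms, and their Dickson matrices -/

section Dickson

variable {F K : Type*} [Field F] [Field K] [Algebra F K]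

theorem linearIndependent_galSum :
    LinearIndependent K fun γ : Gal(K/F) => (γ : K →ₐ[F] K).toLinearMap :=
  (linearIndependent_toLinearMap F K K).comp (fun γ : Gal(K/F) => (γ : K →ₐ[F] K))
    AlgEquiv.coe_toAlgHom_injective

/-- The Dickson matrix of the linear map `x ↦ ∑ γ, c γ * γ x`. -/
def dickson (c : Gal(K/F) → K) : Matrix Gal(K/F) Gal(K/F) K :=
  Matrix.of fun α β => α (c (α⁻¹ * β))

theorem dickson_apply (c : Gal(K/F) → K) (α β : Gal(K/F)) :
    dickson c α β = α (c (α⁻¹ * β)) := rfl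

variable [FiniteDimensional F K]

/-- The linear map `x ↦ ∑ γ, c γ * γ x`. -/
noncomputable def galSum (c : Gal(K/F) → K) : K →ₗ[F] K :=
  ∑ γ, c γ • (γ : K →ₐ[F] K).toLinearMap

theorem galSum_apply (c : Gal(K/F) → K) (x : K) : galSum c x = ∑ γ, c γ * γ x := by
  simp [galSum]

theorem galSum_injective : Function.Injective (galSum : (Gal(K/F) → K) → K →ₗ[F] K) := by
  intro c d h
  have h0 : ∑ γ, (c γ - d γ) • (γ : K →ₐ[F] K).toLinearMap = 0 := by
    have h1 : ∑ γ, c γ • (γ : K →ₐ[F] K).toLinearMap = ∑ γ, d γ • (γ : K →ₐ[F] K).toLinearMap := h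
    rw [← sub_eq_zero, ← Finset.sum_sub_distrib] at h1
    rw [← h1]
    exact Finset.sum_congr rfl fun γ _ => by ext x; simp [sub_mul]
  have h2 := Fintype.linearIndependent_iff.1 (linearIndependent_galSum (F := F) (K := K))
    (fun γ => c γ - d γ) h0
  funext γ
  exact sub_eq_zero.1 (h2 γ)

/-- The n automorphisms are linearly independent over K, and the F-linear endomorphisms of K form a
K-space of dimension n. -/
theorem galSum_surjective [IsGalois F K] :
    Function.Surjective (galSum : (Gal(K/F) → K) → K →ₗ[F] K) := by
  intro h
  have hs := linearIndependent_galSum (F := F) (K := K)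
    |>.span_eq_top_of_card_eq_finrank' (by
      rw [Module.finrank_linearMap_self, ← Nat.card_eq_fintype_card, IsGalois.card_aut_eq_finrank])
  obtain ⟨c, hc⟩ := (Submodule.mem_span_range_iff_exists_fun K).1
    (hs ▸ Submodule.mem_top : h ∈ Submodule.span K _)
  exact ⟨c, hc⟩

theorem dickson_mulVec (c : Gal(K/F) → K) (x : K) :
    (dickson c).mulVec (fun β => β x) = fun α => α (galSum c x) := by
  funext α
  simp only [Matrix.mulVec, dotProduct, dickson_apply, galSum_apply, map_sum, map_mul]
  exact Fintype.sum_equiv (Equiv.mulLeft α⁻¹) _ _ fun β => by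
    rw [Equiv.coe_mulLeft, ← AlgEquiv.mul_apply, mul_inv_cancel_left]

/-- The set of all quotients `h x / x` with `x ≠ 0`. -/
def valueSet (h : K →ₗ[F] K) : Set K := {z | ∃ x, x ≠ 0 ∧ h x = z * x}

/-- `h` is scattered if each quotient `h x / x` is attained on a single `F`-line. -/
def IsScattered (h : K →ₗ[F] K) : Prop :=
  ∀ x y, x ≠ 0 → y ≠ 0 → h x * y = h y * x → ∃ a : F, x = algebraMap F K a * y

-- The automorphisms are the maps z ↦ z^(q^i) with i < n. Uniqueness of base-q digits separates the
-- subset sums, and the total is a geometric sum.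
variable (F K) in
theorem exists_frobenius_exponents [Finite F] : ∃ w : Gal(K/F) → ℕ,
    (∀ α z, α z = z ^ w α) ∧ (Function.Injective fun s : Finset Gal(K/F) => ∑ i ∈ s, w i) ∧
    (∑ i, w i) * (Nat.card F - 1) = Nat.card K - 1 := by
  have := Fintype.ofFinite F
  have : Finite K := Module.finite_of_finite F
  set e := Equiv.ofBijective _ (FiniteField.bijective_frobeniusAlgEquivOfAlgebraic_pow F K) with he
  have hq : 2 ≤ Nat.card F := Finite.one_lt_card
  have hinj : Function.Injective fun α => ((e.symm α : Fin _) : ℕ) :=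
    Fin.val_injective.comp e.symm.injective
  refine ⟨fun α => Nat.card F ^ (e.symm α : ℕ), fun α z => ?_, fun s t hst => ?_, ?_⟩
  · obtain ⟨i, rfl⟩ := e.surjective α
    simp only [e.symm_apply_apply]
    simp only [he, Equiv.ofBijective_apply]
    rw [AlgEquiv.coe_pow, FiniteField.coe_frobeniusAlgEquivOfAlgebraic_iterate,
      Nat.card_eq_fintype_card]
  · have h1 : ∀ u : Finset Gal(K/F), ∑ α ∈ u, Nat.card F ^ (e.symm α : ℕ) =
        ∑ i ∈ u.map ⟨_, hinj⟩, Nat.card F ^ i := fun u => by simp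
    simp only [h1] at hst
    exact Finset.map_injective _ (Finset.geomSum_injective hq hst)
  · rw [Equiv.sum_comp e.symm (fun i => Nat.card F ^ (i : ℕ)),
      Fin.sum_univ_eq_sum_range (fun i => Nat.card F ^ i), Nat.geomSum_eq hq,
      Module.natCard_eq_pow_finrank (K := F) (V := K)]
    exact Nat.div_mul_cancel (Nat.sub_one_dvd_pow_sub_one _ _)

/-- If h x = z x, the vector of all conjugates of x lies in the kernel of diag(α(−z)) + D. -/
theorem eval_weightedCharpoly_dickson {w : Gal(K/F) → ℕ} (hw : ∀ α z, α z = z ^ w α)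
    (c : Gal(K/F) → K) {z : K} (hz : z ∈ valueSet (galSum c)) [DecidableEq Gal(K/F)] :
    (Matrix.weightedCharpoly w (dickson c)).eval (-z) = 0 := by
  obtain ⟨x, hx, hxz⟩ := hz
  rw [Matrix.eval_weightedCharpoly, ← Matrix.exists_mulVec_eq_zero_iff]
  refine ⟨fun β => β x, fun h => hx ?_, ?_⟩
  · simpa using congrFun h 1
  · rw [Matrix.add_mulVec, dickson_mulVec]
    funext α
    simp [Matrix.mulVec_diagonal, hxz, ← hw]

/-- Each fibre of x ↦ h x / x on nonzero elements lies in one F-line, hence has at most q − 1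
elements. -/
theorem card_le_ncard_valueSet [Finite F] {h : K →ₗ[F] K} (hs : IsScattered h) :
    Nat.card K - 1 ≤ (valueSet h).ncard * (Nat.card F - 1) := by
  classical
  have := Fintype.ofFinite F
  have : Finite K := Module.finite_of_finite F
  have := Fintype.ofFinite K
  have hfin : (valueSet h).Finite := Set.toFinite _
  rw [Set.ncard_eq_toFinset_card _ hfin, mul_comm, Nat.card_eq_fintype_card,
    Nat.card_eq_fintype_card]
  have h1 : (Finset.univ.erase (0 : K)).card = Fintype.card K - 1 := by
    rw [Finset.card_erase_of_mem (Finset.mem_univ _), Finset.card_univ]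
  rw [← h1]
  refine Finset.card_le_mul_card_image_of_maps_to (f := fun x => h x / x) (fun x hx => ?_) _
    fun z hz => ?_
  · have hx : x ≠ 0 := by simpa using hx
    exact (Set.Finite.mem_toFinset _).2 ⟨x, hx, by field_simp⟩
  · obtain ⟨y, hy, hyz⟩ := (Set.Finite.mem_toFinset _).1 hz
    have h2 : (Finset.univ.erase (0 : F)).card = Fintype.card F - 1 := by
      rw [Finset.card_erase_of_mem (Finset.mem_univ _), Finset.card_univ]
    rw [← h2]
    refine Finset.card_le_card_of_surjOn (fun a => algebraMap F K a * y) fun x hx => ?_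
    simp only [Finset.coe_filter, Finset.mem_erase, Finset.mem_univ, and_true,
      Set.mem_ofPred_eq] at hx
    obtain ⟨hx0, hxz⟩ := hx
    obtain ⟨a, ha⟩ := hs x y hx0 hy (by
      rw [hyz, ← hxz]; field_simp)
    refine ⟨a, ?_, ha.symm⟩
    simp only [Finset.coe_erase, Finset.coe_univ, Set.mem_sdiff, Set.mem_univ, true_and,
      Set.mem_singleton_iff]
    rintro rfl
    simp at ha
    exact hx0 ha

theorem sum_exponents_le_ncard [Finite F] {w : Gal(K/F) → ℕ}
    (hsum : (∑ i, w i) * (Nat.card F - 1) = Nat.card K - 1) {h : K →ₗ[F] K} (hs : IsScattered h) :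
    ∑ i, w i ≤ (valueSet h).ncard := by
  have hq : 0 < Nat.card F - 1 := by
    have : 1 < Nat.card F := Finite.one_lt_card
    omega
  exact Nat.le_of_mul_le_mul_right (hsum ▸ card_le_ncard_valueSet hs) hq

/-- If a scattered map has the same value set as another one, then all the principal minors of
their Dickson matrices agree. -/
theorem det_dickson_submatrix_eq [Finite F] {c d : Gal(K/F) → K}
    (hs : IsScattered (galSum d)) (h : valueSet (galSum c) = valueSet (galSum d))
    {ι : Type*} [Fintype ι] [DecidableEq ι] (e : ι ↪ Gal(K/F)) :
    ((dickson c).submatrix e e).det = ((dickson d).submatrix e e).det := by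
  classical
  have : Finite K := Module.finite_of_finite F
  obtain ⟨w, hw, hinj, hsum⟩ := exists_frobenius_exponents F K
  refine Matrix.det_submatrix_eq_of_weightedCharpoly_eq hinj ?_ e
  have hfin : (valueSet (galSum d)).Finite := Set.toFinite _
  -- Both polynomials are monic of the same degree and vanish at the negatives of the common values.
  -- There are at least as many values as the degree, so the difference, being of smaller degree, is
  -- zero.
  refine Polynomial.eq_of_degree_sub_lt_of_eval_finset_eq
    (hfin.toFinset.map ⟨Neg.neg, neg_injective⟩) ?_ ?_
  · rw [Finset.card_map, ← Set.ncard_eq_toFinset_card]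
    refine lt_of_lt_of_le ?_ (WithBot.coe_le_coe.2 (sum_exponents_le_ncard hsum hs))
    rw [← sub_sub_sub_cancel_right _ _ (Polynomial.X ^ (∑ i, w i))]
    exact (Polynomial.degree_sub_le _ _).trans_lt (max_lt
      (Matrix.degree_weightedCharpoly_sub_lt hinj _) (Matrix.degree_weightedCharpoly_sub_lt hinj _))
  · intro y hy
    obtain ⟨z, hz, rfl⟩ := Finset.mem_map.1 hy
    rw [Set.Finite.mem_toFinset] at hz
    simp only [Function.Embedding.coeFn_mk]
    rw [eval_weightedCharpoly_dickson hw _ hz, eval_weightedCharpoly_dickson hw _ (h ▸ hz)]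

/-- A scattered map and its adjoint, if scattered as well, have the same value set. -/
theorem valueSet_eq_of_dickson_transpose [Finite F] {c d : Gal(K/F) → K}
    (hc : IsScattered (galSum c)) (hd : IsScattered (galSum d))
    (h : dickson d = (dickson c).transpose) :
    valueSet (galSum c) = valueSet (galSum d) := by
  classical
  have : Finite K := Module.finite_of_finite F
  obtain ⟨w, hw, hinj, hsum⟩ := exists_frobenius_exponents F K
  have hp : Matrix.weightedCharpoly w (dickson d) = Matrix.weightedCharpoly w (dickson c) := by
    rw [h, Matrix.weightedCharpoly_transpose]
  set p := Matrix.weightedCharpoly w (dickson c) with hpdef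
  have hlt := Matrix.degree_weightedCharpoly_sub_lt hinj (dickson c)
  have hdeg : p.degree = ((∑ i, w i : ℕ) : WithBot ℕ) := by
    have : p = (p - Polynomial.X ^ (∑ i, w i)) + Polynomial.X ^ (∑ i, w i) := by ring
    rw [this, Polynomial.degree_add_eq_right_of_degree_lt, Polynomial.degree_X_pow]
    rw [Polynomial.degree_X_pow]
    exact hlt
  have hp0 : p ≠ 0 := fun h0 => by
    rw [h0, Polynomial.degree_zero] at hdeg
    exact WithBot.bot_ne_coe hdeg
  -- Scatteredness gives at least as many values as the degree of `p`, so their negatives are all of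
  -- the roots. Transposing the matrix does not change `p`.
  have key : ∀ b : Gal(K/F) → K, IsScattered (galSum b) →
      Matrix.weightedCharpoly w (dickson b) = p →
      Neg.neg '' valueSet (galSum b) = p.roots.toFinset := by
    intro b hb hbp
    have hfin : (valueSet (galSum b)).Finite := Set.toFinite _
    have h1 : hfin.toFinset.map ⟨Neg.neg, neg_injective⟩ = p.roots.toFinset := by
      refine Finset.eq_of_subset_of_card_le (fun y hy => ?_) ?_
      · obtain ⟨z, hz, rfl⟩ := Finset.mem_map.1 hy
        rw [Set.Finite.mem_toFinset] at hz
        rw [Multiset.mem_toFinset, Polynomial.mem_roots hp0, ← hbp]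
        exact eval_weightedCharpoly_dickson hw _ hz
      · rw [Finset.card_map, ← Set.ncard_eq_toFinset_card]
        refine le_trans ?_ (sum_exponents_le_ncard hsum hb)
        refine (Multiset.toFinset_card_le _).trans ?_
        have := Polynomial.card_roots hp0
        rw [hdeg] at this
        exact_mod_cast this
    rw [← h1]
    simp
  have := (key c hc rfl).trans (key d hd hp).symm
  exact Set.image_injective.2 neg_injective this

theorem algebraMap_norm_eq_prod_pow_generator [IsGalois F K] {σ : Gal(K/F)}
    (hσ : orderOf σ = Module.finrank F K) (x : K) :
    algebraMap F K (Algebra.norm F x) = ∏ i ∈ Finset.range (Module.finrank F K), (σ ^ i) x := by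
  classical
  rw [Algebra.norm_eq_prod_automorphisms]
  symm
  refine Finset.prod_bij (fun i _ => σ ^ i) (fun _ _ => Finset.mem_univ _) (fun i hi j hj h => ?_)
    (fun α _ => ?_) fun _ _ => rfl
  · rw [Finset.mem_range, ← hσ] at hi hj
    exact pow_injOn_Iio_orderOf hi hj h
  · have hmem : α ∈ Subgroup.zpowers σ := by
      have : Subgroup.zpowers σ = ⊤ := by
        rw [← Subgroup.card_eq_iff_eq_top, Nat.card_zpowers, hσ, IsGalois.card_aut_eq_finrank]
      rw [this]; trivial
    obtain ⟨i, hi, rfl⟩ := Finset.mem_image.1 ((mem_zpowers_iff_mem_range_orderOf).1 hmem)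
    exact ⟨i, hσ ▸ hi, rfl⟩

theorem exists_pow_eq_of_orderOf_eq [IsGalois F K] {σ : Gal(K/F)}
    (hσ : orderOf σ = Module.finrank F K) (α : Gal(K/F)) :
    ∃ i < Module.finrank F K, σ ^ i = α := by
  classical
  have hmem : α ∈ Subgroup.zpowers σ := by
    have : Subgroup.zpowers σ = ⊤ := by
      rw [← Subgroup.card_eq_iff_eq_top, Nat.card_zpowers, hσ, IsGalois.card_aut_eq_finrank]
    rw [this]; trivial
  obtain ⟨i, hi, rfl⟩ := Finset.mem_image.1 ((mem_zpowers_iff_mem_range_orderOf).1 hmem)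
  exact ⟨i, hσ ▸ Finset.mem_range.1 hi, rfl⟩

end Dickson

/-! ### The coefficients of a map with the value set of a Lunardon-Polverino map -/

section Binomial

variable {F K : Type*} [Field F] [Field K] [Algebra F K]

open Classical in
/-- The coefficients of `x ↦ a * σ x + b * σ⁻¹ x`. -/
noncomputable def binomialCoeff (σ : Gal(K/F)) (a b : K) : Gal(K/F) → K :=
  Pi.single σ a + Pi.single σ⁻¹ b

theorem binomialCoeff_self {σ : Gal(K/F)} (hσ : σ ≠ σ⁻¹) (a b : K) :
    binomialCoeff σ a b σ = a := by
  simp [binomialCoeff, hσ]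

theorem binomialCoeff_inv {σ : Gal(K/F)} (hσ : σ ≠ σ⁻¹) (a b : K) :
    binomialCoeff σ a b σ⁻¹ = b := by
  simp [binomialCoeff, hσ.symm]

theorem binomialCoeff_of_ne {σ γ : Gal(K/F)} (h : γ ≠ σ) (h' : γ ≠ σ⁻¹) (a b : K) :
    binomialCoeff σ a b γ = 0 := by
  simp [binomialCoeff, h, h']

theorem dickson_pow (c : Gal(K/F) → K) (σ : Gal(K/F)) (i m : ℕ) :
    dickson c (σ ^ i) (σ ^ (i + m)) = (σ ^ i) (c (σ ^ m)) := by
  rw [dickson_apply, pow_add, inv_mul_cancel_left]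

theorem dickson_pow' (c : Gal(K/F) → K) (σ : Gal(K/F)) (i m : ℕ) :
    dickson c (σ ^ (i + m)) (σ ^ i) = (σ ^ (i + m)) (c (σ ^ m)⁻¹) := by
  rw [dickson_apply, pow_add, mul_inv_rev, inv_mul_cancel_right]

theorem galSum_binomialCoeff [FiniteDimensional F K] (σ : Gal(K/F)) (a b x : K) :
    galSum (binomialCoeff σ a b) x = a * σ x + b * σ⁻¹ x := by
  classical
  rw [galSum_apply]
  simp only [binomialCoeff, Pi.add_apply, add_mul, Finset.sum_add_distrib]
  congr 1
  · rw [Finset.sum_eq_single σ] <;> simp +contextual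
  · rw [Finset.sum_eq_single σ⁻¹] <;> simp +contextual

theorem norm_algEquiv_apply (σ : Gal(K/F)) (x : K) :
    Algebra.norm F (σ x) = Algebra.norm F x :=
  Algebra.norm_eq_of_algEquiv σ x

/-- Minors of order one make the diagonals vanish; those of order two are then the negatives of the
products in question. -/
theorem dickson_diag_mul_eq_of_det {c d : Gal(K/F) → K}
    (h : ∀ (k : ℕ) (e : Fin k ↪ Gal(K/F)),
      ((dickson c).submatrix e e).det = ((dickson d).submatrix e e).det) (hd : d 1 = 0) :
    c 1 = 0 ∧ ∀ α β, dickson c α β * dickson c β α = dickson d α β * dickson d β α := by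
  have h1 : ∀ α, dickson c α α = 0 := fun α => by
    have := h 1 ⟨fun _ => α, fun i j _ => Subsingleton.elim i j⟩
    simpa [Matrix.det_fin_one, dickson_apply, hd] using this
  have h1' : ∀ α, dickson d α α = 0 := fun α => by simp [dickson_apply, hd]
  refine ⟨by simpa [dickson_apply] using h1 1, fun α β => ?_⟩
  by_cases hαβ : α = β
  · subst hαβ; rw [h1, h1']
  · have := h 2 ⟨![α, β], fun i j hij => by
      fin_cases i <;> fin_cases j <;> simp_all [eq_comm]⟩
    rw [Matrix.det_fin_two, Matrix.det_fin_two] at this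
    have this : dickson c α α * dickson c β β - dickson c α β * dickson c β α =
      dickson d α α * dickson d β β - dickson d α β * dickson d β α := this
    rw [h1, h1'] at this
    linear_combination -this

variable [FiniteDimensional F K]

theorem mem_range_algebraMap_of_fixed [IsGalois F K] {σ : Gal(K/F)}
    (hσ : orderOf σ = Module.finrank F K) {x : K} (hx : σ x = x) :
    ∃ a : F, algebraMap F K a = x := by
  refine (IsGalois.mem_range_algebraMap_iff_fixed x).2 fun α => ?_
  obtain ⟨i, -, rfl⟩ := exists_pow_eq_of_orderOf_eq hσ α
  induction i with
  | zero => rfl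
  | succ i ih => rw [pow_succ, AlgEquiv.mul_apply, hx, ih]

/-- If two quotients agree, w = σ(x)y − xσ(y) satisfies aw = bσ⁻¹(w). Taking norms forces w = 0, so
x/y is fixed by σ, a generator of the Galois group. -/
theorem isScattered_binomial [IsGalois F K] {σ : Gal(K/F)}
    (hσ : orderOf σ = Module.finrank F K) {a b : K} (hab : Algebra.norm F a ≠ Algebra.norm F b) :
    IsScattered (galSum (binomialCoeff σ a b)) := by
  intro x y hx hy h
  rw [galSum_binomialCoeff, galSum_binomialCoeff] at h
  have hw : a * (σ x * y - x * σ y) = b * σ⁻¹ (σ x * y - x * σ y) := by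
    simp only [map_sub, map_mul]
    have : ∀ z, σ⁻¹ (σ z) = z := fun z => by rw [← AlgEquiv.mul_apply]; simp
    rw [this, this]
    linear_combination h
  have h0 : σ x * y - x * σ y = 0 := by
    by_contra hne
    apply hab
    have := congrArg (Algebra.norm F) hw
    rw [map_mul, map_mul, norm_algEquiv_apply] at this
    exact mul_right_cancel₀ (by simpa [Algebra.norm_eq_zero_iff] using hne) this
  obtain ⟨c, hc⟩ := mem_range_algebraMap_of_fixed hσ (x := x / y) (by
    rw [map_div₀, div_eq_div_iff (by simpa using hy) hy]
    linear_combination h0)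
  exact ⟨c, by rw [hc]; field_simp⟩

theorem ne_inv_of_orderOf {G : Type*} [Group G] {σ : G} {n : ℕ} (hσ : orderOf σ = n)
    (hn : 3 ≤ n) : σ ≠ σ⁻¹ := by
  intro h
  have : σ ^ 2 = 1 := by rw [pow_two]; nth_rewrite 2 [h]; simp
  have := Nat.le_of_dvd (by norm_num) (orderOf_dvd_of_pow_eq_one this)
  omega

theorem inv_eq_pow_pred {G : Type*} [Group G] {σ : G} {n : ℕ} (hσ : orderOf σ = n)
    (hn : 1 ≤ n) : σ⁻¹ = σ ^ (n - 1) := by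
  rw [inv_eq_iff_mul_eq_one, ← pow_succ', Nat.sub_add_cancel hn, ← hσ, pow_orderOf_eq_one]

theorem pow_ne_self_and_inv {G : Type*} [Group G] {σ : G} {n : ℕ} (hσ : orderOf σ = n)
    {k : ℕ} (hk : 2 ≤ k) (hkn : k + 2 ≤ n) : σ ^ k ≠ σ ∧ σ ^ k ≠ σ⁻¹ := by
  constructor
  · intro h
    have : k = 1 := pow_injOn_Iio_orderOf (x := σ) (show k < orderOf σ by omega)
      (show 1 < orderOf σ by omega) (by simpa using h)
    omega
  · intro h
    rw [inv_eq_pow_pred hσ (by omega)] at h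
    have : k = n - 1 := pow_injOn_Iio_orderOf (x := σ) (show k < orderOf σ by omega)
      (show n - 1 < orderOf σ by omega) h
    omega

/-- The embedding `i ↦ σ ^ i` of an initial segment into the group. -/
def powEmbedding {G : Type*} [Group G] (σ : G) (k : ℕ) (hk : k ≤ orderOf σ) : Fin k ↪ G :=
  ⟨fun i => σ ^ (i : ℕ), fun i j h => Fin.ext (pow_injOn_Iio_orderOf
    (show (i : ℕ) < orderOf σ by omega) (show (j : ℕ) < orderOf σ by omega) h)⟩

-- The entry at (σ^i, σ^j) is a conjugate of the coefficient of σ^(j−i). Only the differences ±1 and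
-- ±k survive, and ±k occurs only in the corners.
omit [FiniteDimensional F K] in
theorem isCyclicTridiagonal_dickson {c : Gal(K/F) → K} {σ : Gal(K/F)} (k : ℕ)
    (hk : k + 1 ≤ orderOf σ) (h0 : c 1 = 0)
    (h : ∀ m, 2 ≤ m → m < k → c (σ ^ m) = 0 ∧ c (σ ^ m)⁻¹ = 0) :
    ((dickson c).submatrix (powEmbedding σ (k + 1) hk)
      (powEmbedding σ (k + 1) hk)).IsCyclicTridiagonal := by
  intro i j hij
  have hij : dickson c (σ ^ (i : ℕ)) (σ ^ (j : ℕ)) ≠ 0 := hij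
  rcases lt_trichotomy (i : ℕ) j with hlt | heq | hlt
  · obtain ⟨m, hm⟩ := Nat.exists_eq_add_of_le hlt.le
    rw [hm, dickson_pow] at hij
    by_cases hm1 : m = 1
    · left; omega
    by_cases hmk : m = k
    · right; right; left
      exact ⟨Fin.ext (show (i : ℕ) = 0 by omega), Fin.ext (show (j : ℕ) = k by omega)⟩
    · rw [(h m (by omega) (by omega)).1] at hij
      simp at hij
  · rw [heq, dickson_apply] at hij
    simp [h0] at hij
  · obtain ⟨m, hm⟩ := Nat.exists_eq_add_of_le hlt.le
    rw [hm, dickson_pow'] at hij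
    by_cases hm1 : m = 1
    · right; left; omega
    by_cases hmk : m = k
    · right; right; right
      exact ⟨Fin.ext (show (i : ℕ) = k by omega), Fin.ext (show (j : ℕ) = 0 by omega)⟩
    · rw [(h m (by omega) (by omega)).2] at hij
      simp at hij

omit [FiniteDimensional F K] in
theorem dickson_cycle_sum_eq [Finite F] [IsGalois F K] {c d : Gal(K/F) → K} {σ : Gal(K/F)}
    (h : ∀ (k : ℕ) (e : Fin k ↪ Gal(K/F)),
      ((dickson c).submatrix e e).det = ((dickson d).submatrix e e).det)
    (hc0 : c 1 = 0) (hd0 : d 1 = 0) (hcσ : c σ ≠ 0) (hdσ : d σ ≠ 0) {k : ℕ} (hk : 2 ≤ k)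
    (hkn : k + 1 ≤ orderOf σ)
    (hc : ∀ m, 2 ≤ m → m < k → c (σ ^ m) = 0 ∧ c (σ ^ m)⁻¹ = 0)
    (hd : ∀ m, 2 ≤ m → m < k → d (σ ^ m) = 0 ∧ d (σ ^ m)⁻¹ = 0) :
    c (σ ^ k) * ∏ i : Fin k, (σ ^ (i + 1 : ℕ)) (c σ⁻¹) +
        (σ ^ k) (c (σ ^ k)⁻¹) * ∏ i : Fin k, (σ ^ (i : ℕ)) (c σ) =
      d (σ ^ k) * ∏ i : Fin k, (σ ^ (i + 1 : ℕ)) (d σ⁻¹) +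
        (σ ^ k) (d (σ ^ k)⁻¹) * ∏ i : Fin k, (σ ^ (i : ℕ)) (d σ) := by
  obtain ⟨-, h2⟩ := dickson_diag_mul_eq_of_det h hd0
  have hsup : ∀ (b : Gal(K/F) → K) (i : Fin k), ((dickson b).submatrix (powEmbedding σ (k + 1) hkn)
      (powEmbedding σ (k + 1) hkn)) i.castSucc i.succ = (σ ^ (i : ℕ)) (b σ) := fun b i => by
    have := dickson_pow b σ i 1
    rw [pow_one] at this
    rw [← this]; rfl
  have hsub : ∀ (b : Gal(K/F) → K) (i : Fin k), ((dickson b).submatrix (powEmbedding σ (k + 1) hkn)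
      (powEmbedding σ (k + 1) hkn)) i.succ i.castSucc = (σ ^ (i + 1 : ℕ)) (b σ⁻¹) := fun b i => by
    have := dickson_pow' b σ i 1
    rw [pow_one] at this
    rw [← this]; rfl
  have hl : ∀ b : Gal(K/F) → K, ((dickson b).submatrix (powEmbedding σ (k + 1) hkn)
      (powEmbedding σ (k + 1) hkn)) 0 (Fin.last k) = b (σ ^ k) := fun b => by
    have := dickson_pow b σ 0 k
    rw [zero_add, pow_zero] at this
    rw [show b (σ ^ k) = (1 : Gal(K/F)) (b (σ ^ k)) from rfl, ← this]; rfl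
  have hl' : ∀ b : Gal(K/F) → K, ((dickson b).submatrix (powEmbedding σ (k + 1) hkn)
      (powEmbedding σ (k + 1) hkn)) (Fin.last k) 0 = (σ ^ k) (b (σ ^ k)⁻¹) := fun b => by
    have := dickson_pow' b σ 0 k
    rw [zero_add, pow_zero] at this
    rw [← this]; rfl
  have key := Matrix.IsCyclicTridiagonal.cycle_sum_eq hk
    (isCyclicTridiagonal_dickson k hkn hd0 hd) (isCyclicTridiagonal_dickson k hkn hc0 hc)
    (fun i => by rw [hsup]; exact (map_ne_zero _).2 hdσ) (fun i => by rw [hsup]; exact (map_ne_zero _).2 hcσ)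
    (fun i j => h2 _ _) (h _ _)
  simpa only [hsup, hsub, hl, hl'] using key

/-- Growing the window 1, σ, …, σ^k one step at a time keeps its minor cyclically tridiagonal. Up to
k = n − 2 each step kills the coefficients of σ^k and σ^(−k); the full window k = n − 1 gives the
equation between norms. -/
theorem coeff_of_valueSet_eq_binomial [Finite F] [IsGalois F K] {σ : Gal(K/F)} {n : ℕ}
    (hσ : orderOf σ = n) (hn : Module.finrank F K = n) (hn4 : 4 ≤ n) {η : K} (hη0 : η ≠ 0)
    (hη : Algebra.norm F η ≠ 1) {c : Gal(K/F) → K}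
    (h : valueSet (galSum c) = valueSet (galSum (binomialCoeff σ 1 η))) :
    (∃ a b, c = binomialCoeff σ a b ∧ a * σ b = σ η ∧
      Algebra.norm F a + Algebra.norm F b = 1 + Algebra.norm F η) := by
  set d := binomialCoeff σ 1 η with hd
  have hs : IsScattered (galSum d) :=
    isScattered_binomial (hσ.trans hn.symm) (by simpa using hη.symm)
  have hdet : ∀ (k : ℕ) (e : Fin k ↪ Gal(K/F)),
      ((dickson c).submatrix e e).det = ((dickson d).submatrix e e).det :=
    fun k e => det_dickson_submatrix_eq hs h e
  have hinv := ne_inv_of_orderOf hσ (by omega)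
  have hσ1 : σ ≠ 1 := by rintro rfl; simp at hσ; omega
  have hdσ : d σ = 1 := binomialCoeff_self hinv _ _
  have hdσ' : d σ⁻¹ = η := binomialCoeff_inv hinv _ _
  have hd0 : d 1 = 0 := binomialCoeff_of_ne hσ1.symm (by simpa [eq_comm] using hσ1) _ _
  obtain ⟨hc0, h2⟩ := dickson_diag_mul_eq_of_det hdet hd0
  have h2' : ∀ γ, c γ * γ (c γ⁻¹) = d γ * γ (d γ⁻¹) := fun γ => by
    simpa [dickson_apply] using h2 1 γ
  have hprod : c σ * σ (c σ⁻¹) = σ η := by rw [h2', hdσ, hdσ', one_mul]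
  have hcσ : c σ ≠ 0 := fun h0 => hη0 (by simpa [h0] using hprod.symm)
  have hcσ' : c σ⁻¹ ≠ 0 := fun h0 => hη0 (by simpa [h0] using hprod.symm)
  have hdk : ∀ k, 2 ≤ k → k + 2 ≤ n → d (σ ^ k) = 0 ∧ d (σ ^ k)⁻¹ = 0 := by
    intro k hk hkn
    obtain ⟨e1, e2⟩ := pow_ne_self_and_inv hσ hk hkn
    exact ⟨binomialCoeff_of_ne e1 e2 _ _, binomialCoeff_of_ne
      (fun h => e2 (inv_eq_iff_eq_inv.1 h)) (fun h => e1 (inv_injective h)) _ _⟩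
  have hck : ∀ k, 2 ≤ k → k + 2 ≤ n → c (σ ^ k) = 0 ∧ c (σ ^ k)⁻¹ = 0 := by
    intro k
    induction k using Nat.strong_induction_on with
    | _ k ih =>
    intro hk hkn
    have hcyc := dickson_cycle_sum_eq hdet hc0 hd0 hcσ (by rw [hdσ]; exact one_ne_zero) hk
      (by omega) (fun m hm hmk => ih m hmk hm (by omega)) (fun m hm hmk => hdk m hm (by omega))
    rw [(hdk k hk hkn).1, (hdk k hk hkn).2] at hcyc
    simp only [zero_mul, map_zero, add_zero] at hcyc
    have hp := h2' (σ ^ k)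
    rw [(hdk k hk hkn).1, zero_mul] at hp
    have n1 : ∏ i : Fin k, (σ ^ (i + 1 : ℕ)) (c σ⁻¹) ≠ 0 :=
      Finset.prod_ne_zero_iff.2 fun i _ => (map_ne_zero _).2 hcσ'
    have n2 : ∏ i : Fin k, (σ ^ (i : ℕ)) (c σ) ≠ 0 :=
      Finset.prod_ne_zero_iff.2 fun i _ => (map_ne_zero _).2 hcσ
    -- The minor of order two kills one of the two terms of the cycle sum, which is zero; so the
    -- other term vanishes too.
    rcases mul_eq_zero.1 hp with h0 | h0
    · refine ⟨h0, ?_⟩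
      rw [h0, zero_mul, zero_add] at hcyc
      exact (map_eq_zero _).1 ((mul_eq_zero.1 hcyc).resolve_right n2)
    · refine ⟨?_, (map_eq_zero _).1 h0⟩
      rw [h0, zero_mul, add_zero] at hcyc
      exact (mul_eq_zero.1 hcyc).resolve_right n1
  refine ⟨c σ, c σ⁻¹, ?_, hprod, ?_⟩
  · funext γ
    by_cases h1 : γ = σ
    · rw [h1, binomialCoeff_self hinv]
    by_cases h2 : γ = σ⁻¹
    · rw [h2, binomialCoeff_inv hinv]
    rw [binomialCoeff_of_ne h1 h2]
    obtain ⟨i, hi, rfl⟩ := exists_pow_eq_of_orderOf_eq (hσ.trans hn.symm) γ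
    rw [hn] at hi
    by_cases hi0 : i = 0
    · subst hi0; simpa using hc0
    by_cases hi1 : i = 1
    · subst hi1; simp at h1
    by_cases hin : i = n - 1
    · rw [hin, ← inv_eq_pow_pred hσ (by omega)] at h2; exact absurd rfl h2
    exact (hck i (by omega) (by omega)).1
  -- At k = n − 1 the corners hold conjugates of the coefficients of σ⁻¹ and σ themselves, and each
  -- cycle product completes to a norm.
  · obtain ⟨k, rfl⟩ : ∃ k, n = k + 1 := ⟨n - 1, by omega⟩
    have hcyc := dickson_cycle_sum_eq hdet hc0 hd0 hcσ (by rw [hdσ]; exact one_ne_zero)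
      (k := k) (by omega) (by omega) (fun m hm hmk => hck m hm (by omega))
      (fun m hm hmk => hdk m hm (by omega))
    have hk : σ ^ k = σ⁻¹ := (inv_eq_pow_pred hσ (by omega)).symm
    have hN : ∀ x, algebraMap F K (Algebra.norm F x) = x * ∏ i : Fin k, (σ ^ (i + 1 : ℕ)) x := by
      intro x
      rw [algebraMap_norm_eq_prod_pow_generator (hσ.trans hn.symm), hn, Finset.prod_range_succ',
        mul_comm, Fin.prod_univ_eq_prod_range (fun i => (σ ^ (i + 1)) x)]
      simp
    have hN' : ∀ x, algebraMap F K (Algebra.norm F x) =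
        (σ ^ k) x * ∏ i : Fin k, (σ ^ (i : ℕ)) x := by
      intro x
      rw [algebraMap_norm_eq_prod_pow_generator (hσ.trans hn.symm), hn, Finset.prod_range_succ,
        mul_comm, Fin.prod_univ_eq_prod_range (fun i => (σ ^ i) x)]
    have e1 : (σ ^ k)⁻¹ = σ := by rw [hk, inv_inv]
    rw [e1, ← hN', ← hN', hk, ← hN, ← hN, hdσ, hdσ'] at hcyc
    apply (algebraMap F K).injective
    simp only [map_add, map_one] at hcyc ⊢
    rw [add_comm, hcyc, add_comm]

end Binomial

/-! ### Comparison of binomial maps related by an invertible matrix -/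

section Comparison

variable {F K : Type*} [Field F] [Field K] [Algebra F K]

/-- The matrix `(A B; C D)` maps the graph of `f₁ τ + f₂ τ⁻¹` into the graph of `a σ + b σ⁻¹`. -/
def MapsGraph (σ τ : Gal(K/F)) (a b f₁ f₂ A B C D : K) : Prop :=
  ∀ x, a * σ (A * x + B * (f₁ * τ x + f₂ * τ⁻¹ x)) + b * σ⁻¹ (A * x + B * (f₁ * τ x + f₂ * τ⁻¹ x)) =
    C * x + D * (f₁ * τ x + f₂ * τ⁻¹ x)

theorem MapsGraph.swap {σ τ : Gal(K/F)} {a b f₁ f₂ A B C D : K}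
    (h : MapsGraph σ τ a b f₁ f₂ A B C D) : MapsGraph σ τ⁻¹ a b f₂ f₁ A B C D := fun x => by
  have := h x
  rw [inv_inv, add_comm (f₂ * _)]
  exact this

variable [FiniteDimensional F K]

open Classical in
theorem MapsGraph.coeff {σ τ : Gal(K/F)} {a b f₁ f₂ A B C D : K}
    (h : MapsGraph σ τ a b f₁ f₂ A B C D) (γ : Gal(K/F)) :
    (if γ = σ then a * σ A else 0) + (if γ = σ⁻¹ then b * σ⁻¹ A else 0) +
      (if γ = σ * τ then a * σ (B * f₁) else 0) + (if γ = σ * τ⁻¹ then a * σ (B * f₂) else 0) +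
      (if γ = σ⁻¹ * τ then b * σ⁻¹ (B * f₁) else 0) +
      (if γ = σ⁻¹ * τ⁻¹ then b * σ⁻¹ (B * f₂) else 0) =
    (if γ = 1 then C else 0) + (if γ = τ then D * f₁ else 0) +
      (if γ = τ⁻¹ then D * f₂ else 0) := by
  have hs : ∀ (α : Gal(K/F)) (z x : K), galSum (Pi.single α z) x = z * α x := fun α z x => by
    rw [galSum_apply, Finset.sum_eq_single α] <;> simp +contextual
  have hadd : ∀ c d : Gal(K/F) → K, ∀ x, galSum (c + d) x = galSum c x + galSum d x := by
    intro c d x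
    simp [galSum_apply, add_mul, Finset.sum_add_distrib]
  have := galSum_injective (F := F) (a₁ := Pi.single σ (a * σ A) + Pi.single σ⁻¹ (b * σ⁻¹ A) +
      Pi.single (σ * τ) (a * σ (B * f₁)) + Pi.single (σ * τ⁻¹) (a * σ (B * f₂)) +
      Pi.single (σ⁻¹ * τ) (b * σ⁻¹ (B * f₁)) + Pi.single (σ⁻¹ * τ⁻¹) (b * σ⁻¹ (B * f₂)))
    (a₂ := Pi.single 1 C + Pi.single τ (D * f₁) + Pi.single τ⁻¹ (D * f₂)) (by
      ext x
      have hx := h x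
      simp only [hadd, hs, AlgEquiv.mul_apply, map_add, map_mul, AlgEquiv.one_apply] at hx ⊢
      linear_combination hx)
  simpa only [Pi.add_apply, Pi.single_apply] using congrFun this γ

/-- Unless one of the two conclusions holds, στ differs from every other automorphism occurring on
either side, and its coefficient aσ(Bf₁) would have to vanish. -/
theorem MapsGraph.eq_sq_of_ne {σ τ : Gal(K/F)} {a b f₁ f₂ A B C D : K}
    (h : MapsGraph σ τ a b f₁ f₂ A B C D) (hcomm : σ * τ = τ * σ) (ha : a ≠ 0) (hf₁ : f₁ ≠ 0)
    (hB : B ≠ 0) (hσ : σ ^ 2 ≠ 1) (hτ : τ ^ 2 ≠ 1) (hστ' : τ ≠ σ⁻¹)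
    (h2 : (σ * τ) ^ 2 ≠ 1) : τ = (σ ^ 2)⁻¹ ∨ σ = (τ ^ 2)⁻¹ := by
  by_contra hne
  push Not at hne
  have hc := h.coeff (σ * τ)
  have hσ1 : σ ≠ 1 := fun h => hσ (by simp [h])
  have hτ1 : τ ≠ 1 := fun h => hτ (by simp [h])
  have g1 : σ * τ ≠ σ := fun e => hτ1 (by simpa using e)
  have g2 : σ * τ ≠ σ⁻¹ := fun e => hne.1 (eq_inv_of_mul_eq_one_right
    (by rw [pow_two, mul_assoc, e, mul_inv_cancel]))
  have g3 : σ * τ ≠ σ * τ⁻¹ := fun e => hτ (by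
    rw [pow_two]; exact mul_eq_one_iff_eq_inv.2 (mul_left_cancel e))
  have g4 : σ * τ ≠ σ⁻¹ * τ := fun e => hσ (by
    rw [pow_two]; exact mul_eq_one_iff_eq_inv.2 (mul_right_cancel e))
  have g5 : σ * τ ≠ σ⁻¹ * τ⁻¹ := fun e => h2 (by
    rw [pow_two]; nth_rewrite 2 [e]; rw [hcomm]; group)
  have g6 : σ * τ ≠ 1 := fun e => hστ' (eq_inv_of_mul_eq_one_right e)
  have g7 : σ * τ ≠ τ := fun e => hσ1 (by simpa using e)
  have g8 : σ * τ ≠ τ⁻¹ := fun e => hne.2 (eq_inv_of_mul_eq_one_left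
    (by rw [pow_two, ← mul_assoc, e, inv_mul_cancel]))
  simp only [g1, g2, g3, g4, g5, g6, g7, g8, if_true, if_false, zero_add, add_zero] at hc
  simp [ha, hf₁, hB] at hc

theorem pow_ne_one_of_lt {G : Type*} [Group G] {σ : G} {n k : ℕ} (hσ : orderOf σ = n)
    (hk : 0 < k) (hkn : k < n) : σ ^ k ≠ 1 :=
  pow_ne_one_of_lt_orderOf hk.ne' (hσ ▸ hkn)

/-- For automorphisms of order `n`, the outer exponents have to agree up to sign, except possibly
if `n = 5`. -/
theorem MapsGraph.eq_or_five [IsGalois F K] {σ τ : Gal(K/F)} {n : ℕ} (hσ : orderOf σ = n)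
    (hτ : orderOf τ = n) (hn : Module.finrank F K = n) (hn4 : 4 ≤ n) {a b f₁ f₂ A B C D : K}
    (h : MapsGraph σ τ a b f₁ f₂ A B C D) (ha : a ≠ 0) (hf₁ : f₁ ≠ 0)
    (hf₂ : f₂ ≠ 0) (hdet : A * D - B * C ≠ 0) :
    τ = σ ∨ τ = σ⁻¹ ∨ (n = 5 ∧ (τ = σ ^ 2 ∨ τ = (σ ^ 2)⁻¹)) := by
  by_contra hne
  push Not at hne
  obtain ⟨h1, h2, h3⟩ := hne
  obtain ⟨j, hj, hjτ⟩ := exists_pow_eq_of_orderOf_eq (hσ.trans hn.symm) τ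
  have hcomm : σ * τ = τ * σ := by rw [← hjτ, ← pow_succ, ← pow_succ']
  have hcomm' : σ * τ⁻¹ = τ⁻¹ * σ := by
    rw [eq_inv_mul_iff_mul_eq, ← mul_assoc, ← hcomm, mul_inv_cancel_right]
  have hσ2 := pow_ne_one_of_lt hσ (k := 2) (by omega) (by omega)
  have hτ2 := pow_ne_one_of_lt hτ (k := 2) (by omega) (by omega)
  have hσ1 : σ ≠ 1 := fun h => hσ2 (by simp [h])
  have hσinv := ne_inv_of_orderOf hσ (by omega)
  have hB : B ≠ 0 := by
    rintro rfl
    have hc := h.coeff σ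
    have g3 : σ ≠ τ⁻¹ := fun e => h2 (by rw [e, inv_inv])
    simp only [hσ1, hσinv, h1.symm, g3, if_false, if_true, zero_mul, map_zero, mul_zero,
      add_zero, ite_self] at hc
    simp only [mul_eq_zero, ha, map_eq_zero, false_or] at hc
    simp [hc] at hdet
  have hτ2' : τ⁻¹ ^ 2 ≠ 1 := by rwa [inv_pow, inv_ne_one]
  -- These are the constraints from the coefficients at στ and, after exchanging τ with τ⁻¹, at
  -- στ⁻¹. In every combination, σ or τ has order dividing 3, 4 or 5, which leaves only n = 4 and n
  -- = 5, where the powers of σ are checked one by one.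
  have k1 : (σ * τ) ^ 2 ≠ 1 → τ = (σ ^ 2)⁻¹ ∨ σ = (τ ^ 2)⁻¹ :=
    h.eq_sq_of_ne hcomm ha hf₁ hB hσ2 hτ2 h2
  have k2 : (σ * τ⁻¹) ^ 2 ≠ 1 → τ = σ ^ 2 ∨ σ = τ ^ 2 := by
    intro h0
    have := h.swap.eq_sq_of_ne hcomm' ha hf₂ hB hσ2 hτ2' (fun e => h1 (inv_injective e)) h0
    simpa using this
  have hC : Commute σ τ := hcomm
  have hC' : Commute σ τ⁻¹ := hcomm'
  by_cases hn5 : n = 5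
  · obtain ⟨h3, h4⟩ := h3 hn5
    have e5 : σ ^ 5 = 1 := by rw [← hn5, ← hσ, pow_orderOf_eq_one]
    have hj5 : j < 5 := by omega
    interval_cases j
    · exact (pow_ne_one_of_lt hτ (k := 1) (by omega) (by omega)) (by simp [← hjτ])
    · exact h1 (by simp [← hjτ])
    · exact h3 hjτ.symm
    · exact h4 (by rw [← hjτ]; exact eq_inv_of_mul_eq_one_left (by rw [← pow_add, e5]))
    · exact h2 (by rw [← hjτ]; exact eq_inv_of_mul_eq_one_left (by rw [← pow_succ, e5]))
  have hσ4 : σ ^ 4 = 1 → False := by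
    intro e4
    have hn' : n = 4 := by
      have := Nat.le_of_dvd (by norm_num) (orderOf_dvd_of_pow_eq_one e4)
      omega
    have hj4 : j < 4 := by omega
    interval_cases j
    · exact (pow_ne_one_of_lt hτ (k := 1) (by omega) (by omega)) (by simp [← hjτ])
    · exact h1 (by simp [← hjτ])
    · exact hτ2 (by rw [← hjτ, ← pow_mul, e4])
    · exact h2 (by rw [← hjτ]; exact eq_inv_of_mul_eq_one_left (by rw [← pow_succ, e4]))
  have hτ4 : τ ^ 4 = 1 → False := fun e => hσ4 (orderOf_dvd_iff_pow_eq_one.1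
    (by rw [hσ, ← hτ]; exact orderOf_dvd_of_pow_eq_one e))
  have hσ5 : σ ^ 5 = 1 → False := fun e => hn5 (by
    have := (Nat.dvd_prime Nat.prime_five).1 (orderOf_dvd_of_pow_eq_one e)
    omega)
  have hτ5 : τ ^ 5 = 1 → False := fun e => hσ5 (orderOf_dvd_iff_pow_eq_one.1
    (by rw [hσ, ← hτ]; exact orderOf_dvd_of_pow_eq_one e))
  have hσ6 : σ ^ 6 = 1 → σ ^ 3 ≠ 1 := fun _ => pow_ne_one_of_lt hσ (by omega) (by omega)
  have hσ3 : σ ^ 3 ≠ 1 := pow_ne_one_of_lt hσ (by omega) (by omega)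
  have hτ3 : τ ^ 3 ≠ 1 := pow_ne_one_of_lt hτ (by omega) (by omega)
  have k12 : (τ = (σ ^ 2)⁻¹ ∨ σ = (τ ^ 2)⁻¹) → (τ = σ ^ 2 ∨ σ = τ ^ 2) → False := by
    rintro (e | e) (e' | e')
    · exact hσ4 (by rw [show 4 = 2 + 2 from rfl, pow_add]; nth_rewrite 1 [← e']; rw [e]; simp)
    · apply hσ5
      have : σ * (σ ^ 2) ^ 2 = 1 := by
        nth_rewrite 1 [e']; rw [e, inv_pow, inv_mul_cancel]
      rw [← this]; group
    · apply hτ5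
      have : τ * (τ ^ 2) ^ 2 = 1 := by
        nth_rewrite 1 [e']; rw [e, inv_pow, inv_mul_cancel]
      rw [← this]; group
    · exact hτ4 (by rw [show 4 = 2 + 2 from rfl, pow_add]; nth_rewrite 1 [← e']; rw [e]; simp)
  by_cases c1 : (σ * τ) ^ 2 = 1
  · by_cases c2 : (σ * τ⁻¹) ^ 2 = 1
    · apply hσ4
      rw [hC.mul_pow] at c1
      rw [hC'.mul_pow, inv_pow, mul_inv_eq_one] at c2
      rw [← c2, ← pow_add] at c1
      exact c1
    · rw [hC.mul_pow] at c1
      rcases k2 c2 with e | e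
      · rw [e, ← pow_mul, ← pow_add] at c1
        have h3' : τ ^ 3 = 1 := by rw [e, ← pow_mul]; exact c1
        exact hτ3 h3'
      · rw [e, ← pow_mul, ← pow_add] at c1
        have h3' : σ ^ 3 = 1 := by rw [e, ← pow_mul]; exact c1
        exact hσ3 h3'
  · have e1 := k1 c1
    by_cases c2 : (σ * τ⁻¹) ^ 2 = 1
    · rw [hC'.mul_pow, inv_pow, mul_inv_eq_one] at c2
      rcases e1 with e | e
      · apply hτ3
        rw [pow_succ, ← c2, e, mul_inv_cancel]
      · apply hσ3
        rw [pow_succ, c2, e, mul_inv_cancel]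
    · exact k12 e1 (k2 c2)

/-- The coefficient at 1 gives C = 0. Eliminating b, respectively a, from the other four yields two
relations between conjugates of A and B; shifted by σ⁻¹ and σ and cross-multiplied, they become
AB·N(f₁) = AB·N(f₂). -/
theorem MapsGraph.norm_eq_of_five [IsGalois F K] {σ : Gal(K/F)} (hσ : orderOf σ = 5)
    (hn : Module.finrank F K = 5) {a b f₁ f₂ A B C D : K}
    (h : MapsGraph σ (σ ^ 2) a b f₁ f₂ A B C D) (ha : a ≠ 0) (hb : b ≠ 0)
    (hdet : A * D - B * C ≠ 0) : Algebra.norm F f₁ = Algebra.norm F f₂ := by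
  have e5 : σ ^ 5 = 1 := by rw [← hσ, pow_orderOf_eq_one]
  have i4 : σ⁻¹ = σ ^ 4 := inv_eq_pow_pred hσ (by omega)
  have i2 : (σ ^ 2)⁻¹ = σ ^ 3 := inv_eq_of_mul_eq_one_right (by rw [← pow_add, e5])
  have m1 : σ * σ ^ 2 = σ ^ 3 := (pow_succ' _ _).symm
  have m2 : σ * σ ^ 3 = σ ^ 4 := (pow_succ' _ _).symm
  have m3 : σ ^ 4 * σ ^ 2 = σ := by
    rw [← pow_add, show 4 + 2 = 5 + 1 from rfl, pow_add, e5, one_mul, pow_one]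
  have m4 : σ ^ 4 * σ ^ 3 = σ ^ 2 := by
    rw [← pow_add, show 4 + 3 = 5 + 2 from rfl, pow_add, e5, one_mul]
  have hne : ∀ i j : ℕ, i < 5 → j < 5 → i ≠ j → σ ^ i ≠ σ ^ j := fun i j hi hj hij h =>
    hij (pow_injOn_Iio_orderOf (x := σ) (show i < orderOf σ by omega)
      (show j < orderOf σ by omega) h)
  have n01 : σ ≠ 1 := by simpa using hne 1 0
  have n12 : σ ≠ σ ^ 2 := by simpa using hne 1 2
  have n13 : σ ≠ σ ^ 3 := by simpa using hne 1 3
  have n14 : σ ≠ σ ^ 4 := by simpa using hne 1 4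
  have n02 : σ ^ 2 ≠ 1 := by simpa using hne 2 0
  have n03 : σ ^ 3 ≠ 1 := by simpa using hne 3 0
  have n04 : σ ^ 4 ≠ 1 := by simpa using hne 4 0
  have n23 : σ ^ 2 ≠ σ ^ 3 := hne 2 3 (by omega) (by omega) (by omega)
  have n24 : σ ^ 2 ≠ σ ^ 4 := hne 2 4 (by omega) (by omega) (by omega)
  have n34 : σ ^ 3 ≠ σ ^ 4 := hne 3 4 (by omega) (by omega) (by omega)
  have c0 := h.coeff 1
  have c1 := h.coeff σ
  have c2 := h.coeff (σ ^ 2)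
  have c3 := h.coeff (σ ^ 3)
  have c4 := h.coeff (σ ^ 4)
  simp only [i4, i2, m1, m2, m3, m4, n01, n02, n03, n04, n12, n13, n14, n23, n24, n34,
    n01.symm, n02.symm, n03.symm, n04.symm, n12.symm, n13.symm, n14.symm, n23.symm, n24.symm,
    n34.symm, if_true, if_false, add_zero, zero_add] at c0 c1 c2 c3 c4
  rw [← c0, mul_zero, sub_zero] at hdet
  have hA : A ≠ 0 := left_ne_zero_of_mul hdet
  have hD : D ≠ 0 := right_ne_zero_of_mul hdet
  have nz : ∀ (α : Gal(K/F)) (x : K), x ≠ 0 → α x ≠ 0 := fun α x hx => (map_ne_zero α).2 hx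
  simp only [map_mul] at c1 c2 c3 c4
  have hB : B ≠ 0 := by
    rintro rfl
    simp [ha, hA] at c1
  have E1 : σ A * f₂ * (σ ^ 4) f₂ = -(σ B * f₁ * σ f₁ * (σ ^ 4) f₁) := by
    refine mul_left_cancel₀ (mul_ne_zero ha hD) ?_
    linear_combination D * f₂ * (σ ^ 4) f₂ * c1 - D * f₂ * (σ ^ 4) f₁ * c2
      + D * f₁ * (σ ^ 4) f₁ * c3
  have E2 : (σ ^ 4) A * f₁ * σ f₁ = -((σ ^ 4) B * f₂ * σ f₂ * (σ ^ 4) f₂) := by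
    refine mul_left_cancel₀ (mul_ne_zero hb hD) ?_
    linear_combination D * f₁ * σ f₁ * c4 - D * f₁ * σ f₂ * c3 + D * f₂ * σ f₂ * c2
  have E1' := congrArg (fun x => (σ ^ 4) x) E1
  have E2' := congrArg (fun x => σ x) E2
  have q1 : ∀ x, (σ ^ 4) (σ x) = x := fun x => by
    rw [← AlgEquiv.mul_apply, ← pow_succ, e5]; rfl
  have q2 : ∀ x, σ ((σ ^ 4) x) = x := fun x => by
    rw [← AlgEquiv.mul_apply, ← pow_succ', e5]; rfl
  have q3 : ∀ x, (σ ^ 4) ((σ ^ 4) x) = (σ ^ 3) x := fun x => by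
    rw [← AlgEquiv.mul_apply, ← pow_add, show 4 + 4 = 5 + 3 from rfl, pow_add, e5, one_mul]
  have q4 : ∀ x, σ (σ x) = (σ ^ 2) x := fun x => by
    rw [← AlgEquiv.mul_apply, pow_two]
  simp only [map_mul, map_neg, q1, q2, q3, q4] at E1' E2'
  apply (algebraMap F K).injective
  have hσn : orderOf σ = Module.finrank F K := hσ.trans hn.symm
  rw [algebraMap_norm_eq_prod_pow_generator hσn, algebraMap_norm_eq_prod_pow_generator hσn, hn]
  simp only [Finset.prod_range_succ, Finset.prod_range_zero, pow_zero, pow_one, one_mul,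
    AlgEquiv.one_apply]
  refine mul_left_cancel₀ (mul_ne_zero hA hB) ?_
  linear_combination B * f₁ * (σ ^ 4) f₁ * (σ ^ 3) f₁ * E2' - B * (f₂ * σ f₂ * (σ ^ 2) f₂) * E1'

/-- If A = 0, the coefficient at σ gives D = 0. The term aσ(Bf₁) at σ² can then be cancelled only by
the one at σ⁻², which requires σ⁴ = 1. -/
theorem MapsGraph.coeff_of_same {σ : Gal(K/F)} {n : ℕ} (hσ : orderOf σ = n)
    (hn4 : 4 ≤ n) {a b f₁ f₂ A B C D : K} (h : MapsGraph σ σ a b f₁ f₂ A B C D)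
    (ha : a ≠ 0) (hf₁ : f₁ ≠ 0) (hdet : A * D - B * C ≠ 0) :
    (A ≠ 0 ∧ D ≠ 0 ∧ a * σ A = D * f₁ ∧ b * σ⁻¹ A = D * f₂) ∨
      (n = 4 ∧ B ≠ 0 ∧ a * σ (B * f₁) + b * σ⁻¹ (B * f₂) = 0) := by
  have hσ2 := pow_ne_one_of_lt hσ (k := 2) (by omega) (by omega)
  have hσ3 := pow_ne_one_of_lt hσ (k := 3) (by omega) (by omega)
  have n1 : σ ≠ 1 := fun h => hσ2 (by simp [h])
  have n2 : σ ≠ σ⁻¹ := ne_inv_of_orderOf hσ (by omega)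
  have n3 : σ ≠ σ * σ := fun e => n1 (by simpa using e)
  have n4 : σ ≠ σ⁻¹ * σ⁻¹ := fun e => hσ3 (by
    rw [pow_succ]; nth_rewrite 2 [e]; group)
  have n5 : σ⁻¹ ≠ σ⁻¹ * σ⁻¹ := fun e => n1 (by simpa using e)
  have n6 : σ⁻¹ ≠ σ * σ := fun e => hσ3 (by
    rw [pow_succ, pow_two, ← e, inv_mul_cancel])
  have n7 : σ * σ ≠ 1 := by rwa [← pow_two]
  have n8 : σ⁻¹ ≠ 1 := by simpa using n1
  have c1 := h.coeff σ
  have c2 := h.coeff σ⁻¹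
  have c3 := h.coeff (σ * σ)
  simp only [n1, n2, n3, n4, n5, n6, n7, n8, n2.symm, n3.symm, n6.symm, mul_inv_cancel,
    inv_mul_cancel, if_true, if_false, add_zero, zero_add] at c1 c2 c3
  by_cases hA : A = 0
  · right
    subst hA
    have hD : D = 0 := by
      simpa [hf₁] using c1
    subst hD
    have hB : B ≠ 0 := fun hB => hdet (by simp [hB])
    by_cases hc : σ * σ = σ⁻¹ * σ⁻¹
    · refine ⟨?_, hB, by simpa [hc] using c3⟩
      have h4 : σ ^ 4 = 1 := by
        rw [show 4 = 2 + 2 from rfl, pow_add, pow_two]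
        nth_rewrite 2 [hc]
        group
      have := Nat.le_of_dvd (by norm_num) (orderOf_dvd_of_pow_eq_one h4)
      omega
    · simp [hc, ha, hB, hf₁] at c3
  · left
    refine ⟨hA, fun hD => ?_, c1, c2⟩
    subst hD
    simp [ha, hA] at c1

/-- The comparison of norms: here `ν` plays the role of the norm to the fixed field of `σ ^ 2`. -/
theorem MapsGraph.exists_relation {σ : Gal(K/F)} {n : ℕ} (hσ : orderOf σ = n)
    (hn4 : 4 ≤ n) {a b f₁ f₂ A B C D η : K} (h : MapsGraph σ σ a b f₁ f₂ A B C D)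
    (ha : a ≠ 0) (hb : b ≠ 0) (hf₁ : f₁ ≠ 0) (hdet : A * D - B * C ≠ 0)
    (hab : a * σ b = σ η) (hnorm : Algebra.norm F a + Algebra.norm F b = 1 + Algebra.norm F η)
    (ν : K →*₀ K) (hν : ∀ x, ν (σ (σ x)) = ν x) (hν1 : n = 4 → ν (-1) = 1)
    (hN : ∀ x, Algebra.norm F x = 1 → ν x * ν (σ x) = 1) :
    ν f₂ = ν η * ν f₁ ∨ ν (σ f₁) = ν η * ν (σ f₂) ∨ ν f₁ = ν (σ η) * ν f₂ ∨
      ν (σ f₂) = ν (σ η) * ν (σ f₁) := by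
  have hinv : ∀ x, ν (σ⁻¹ x) = ν (σ x) := fun x => by
    rw [← hν (σ⁻¹ x), ← AlgEquiv.mul_apply σ σ⁻¹, mul_inv_cancel, AlgEquiv.one_apply]
  have nz : ∀ x, x ≠ 0 → ν x ≠ 0 := fun x hx => (map_ne_zero ν).2 hx
  have nzσ : ∀ x, x ≠ 0 → ν (σ x) ≠ 0 := fun x hx => nz _ ((map_ne_zero σ).2 hx)
  have h1 : ν a * ν (σ b) = ν (σ η) := by rw [← map_mul, hab]
  have h2 : ν (σ a) * ν b = ν η := by
    have := congrArg (fun x => ν (σ x)) hab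
    simpa [hν] using this
  have hNη : Algebra.norm F a * Algebra.norm F b = Algebra.norm F η := by
    have := congrArg (Algebra.norm F) hab
    rwa [map_mul, norm_algEquiv_apply, norm_algEquiv_apply] at this
  -- N(a) and N(b) have the same sum and product as 1 and N(η), so one of them equals 1.
  have h12 : (Algebra.norm F a - 1) * (Algebra.norm F b - 1) = 0 := by
    linear_combination hNη - hnorm
  have key : ν a * ν f₂ = ν b * ν f₁ ∨ ν a * ν (σ f₁) = ν b * ν (σ f₂) := by
    rcases h.coeff_of_same hσ hn4 ha hf₁ hdet with ⟨hA, hD, e1, e2⟩ | ⟨hn, hB, e⟩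
    · left
      have e1 := congrArg ν e1
      have e2 := congrArg ν e2
      simp only [map_mul, hinv] at e1 e2
      refine mul_left_cancel₀ (mul_ne_zero (nz _ hD) (nzσ _ hA)) ?_
      linear_combination ν D * ν f₂ * e1 - ν D * ν f₁ * e2
    -- In the case n = 4 the relation carries a sign, which is harmless because ν(−1) = 1.
    · right
      have e : a * σ (B * f₁) = (-1) * (b * σ⁻¹ (B * f₂)) := by linear_combination e
      have e := congrArg ν e
      simp only [map_mul, hinv, hν1 hn] at e
      refine mul_left_cancel₀ (nzσ _ hB) ?_
      linear_combination e
  rcases mul_eq_zero.1 h12 with h0 | h0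
  · have hn1 := hN a (sub_eq_zero.1 h0)
    rcases key with e | e
    · left
      refine mul_left_cancel₀ (nz _ ha) ?_
      linear_combination e - ν f₁ * ν b * hn1 + ν a * ν f₁ * h2
    · right; left
      refine mul_left_cancel₀ (nz _ ha) ?_
      linear_combination e - ν (σ f₂) * ν b * hn1 + ν a * ν (σ f₂) * h2
  · have hn1 := hN b (sub_eq_zero.1 h0)
    rcases key with e | e
    · right; right; left
      refine mul_left_cancel₀ (nz _ hb) ?_
      linear_combination -e - ν f₂ * ν a * hn1 + ν b * ν f₂ * h1
    · right; right; right
      refine mul_left_cancel₀ (nz _ hb) ?_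
      linear_combination -e - ν (σ f₁) * ν a * hn1 + ν b * ν (σ f₁) * h1

end Comparison

/-! ### Linear sets of graphs and semilinear equivalence -/

section Projective

variable {F K : Type*} [Field F] [Field K] [Algebra F K]

theorem mk_mem_linearSet_graph {h : K →ₗ[F] K} {P : ℙ K (K × K)} :
    P ∈ linearSet h.graph ↔ ∃ (x : K) (hx : x ≠ 0),
      P = Projectivization.mk K (x, h x) (fun h0 => hx (Prod.ext_iff.1 h0).1) := by
  constructor
  · rintro ⟨u, hu, hmem, rfl⟩
    rw [LinearMap.mem_graph_iff] at hmem
    obtain ⟨x, y⟩ := u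
    simp only at hmem
    subst hmem
    refine ⟨x, ?_, rfl⟩
    rintro rfl
    simp at hu
  · rintro ⟨x, hx, rfl⟩
    exact ⟨_, _, by simp [LinearMap.mem_graph_iff], rfl⟩

theorem linearSet_graph_eq_of_valueSet_eq {g h : K →ₗ[F] K} (e : valueSet g = valueSet h) :
    linearSet g.graph = linearSet h.graph := by
  have key : ∀ g h : K →ₗ[F] K, valueSet g = valueSet h →
      linearSet g.graph ⊆ linearSet h.graph := by
    intro g h e P hP
    obtain ⟨x, hx, rfl⟩ := mk_mem_linearSet_graph.1 hP
    have : g x / x ∈ valueSet h := e ▸ ⟨x, hx, by field_simp⟩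
    obtain ⟨y, hy, hyz⟩ := this
    refine mk_mem_linearSet_graph.2 ⟨y, hy, ?_⟩
    rw [Projectivization.mk_eq_mk_iff']
    refine ⟨x / y, ?_⟩
    ext
    · simp [hy]
    · simp only [Prod.smul_mk, smul_eq_mul, hyz]
      field_simp
  exact (key g h e).antisymm (key h g e.symm)

/-- Two subsets of the projective line are equivalent if an element of `PΓL(2, K)` maps one onto
the other. -/
def SemilinearEquivalent (L M : Set (ℙ K (K × K))) : Prop := ∃ g ∈ PGammaL K, g '' L = M

theorem SemilinearEquivalent.refl (L : Set (ℙ K (K × K))) : SemilinearEquivalent L L :=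
  ⟨1, one_mem _, by simp⟩

theorem SemilinearEquivalent.trans {L M N : Set (ℙ K (K × K))} (h : SemilinearEquivalent L M)
    (h' : SemilinearEquivalent M N) : SemilinearEquivalent L N := by
  obtain ⟨g, hg, rfl⟩ := h
  obtain ⟨g', hg', rfl⟩ := h'
  exact ⟨g' * g, mul_mem hg' hg, by rw [← Set.image_comp]; rfl⟩

theorem semilinearEquivalent_of_diagonal {g h : K →ₗ[F] K} (τ : K ≃+* K) {A D : K} (hA : A ≠ 0)
    (hD : D ≠ 0) (e : ∀ x, D * τ (g x) = h (A * τ x)) :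
    SemilinearEquivalent (linearSet g.graph) (linearSet h.graph) := by
  let φ : (K × K) →ₛₗ[(τ : K →+* K)] (K × K) :=
    { toFun := fun v => (A * τ v.1, D * τ v.2)
      map_add' := fun v w => by simp [mul_add]
      map_smul' := fun c v => by
        ext <;> simp [mul_left_comm] }
  have hφa : ∀ v, φ v = (A * τ v.1, D * τ v.2) := fun v => rfl
  have hφ : Function.Bijective φ := by
    constructor
    · intro v w hvw
      rw [hφa, hφa, Prod.mk.injEq] at hvw
      exact Prod.ext (τ.injective (mul_left_cancel₀ hA hvw.1))
        (τ.injective (mul_left_cancel₀ hD hvw.2))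
    · intro w
      refine ⟨(τ.symm (w.1 / A), τ.symm (w.2 / D)), ?_⟩
      rw [hφa]
      ext
      · simp [mul_div_cancel₀ _ hA]
      · simp [mul_div_cancel₀ _ hD]
  have := RingHomInvPair.of_ringEquiv τ
  have hb : Function.Bijective (Projectivization.map φ hφ.injective) := by
    refine ⟨Projectivization.map_injective (τ := (τ.symm : K →+* K)) _ _, fun P => ?_⟩
    induction P using Projectivization.ind with
    | h w hw =>
      obtain ⟨v, rfl⟩ := hφ.surjective w
      exact ⟨Projectivization.mk K v fun h0 => hw (by rw [h0, map_zero]), by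
        rw [Projectivization.map_mk]⟩
  refine ⟨Equiv.ofBijective _ hb, ⟨τ, φ, hφ, fun P => rfl⟩, ?_⟩
  ext P
  simp only [Set.mem_image, Equiv.ofBijective_apply]
  constructor
  · rintro ⟨P, hP, rfl⟩
    obtain ⟨x, hx, rfl⟩ := mk_mem_linearSet_graph.1 hP
    refine mk_mem_linearSet_graph.2 ⟨A * τ x, mul_ne_zero hA (by simpa using hx), ?_⟩
    rw [Projectivization.map_mk]
    congr 1
    rw [hφa, e]
  · intro hP
    obtain ⟨y, hy, rfl⟩ := mk_mem_linearSet_graph.1 hP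
    have hyA : A * τ (τ.symm (y / A)) = y := by simp [mul_div_cancel₀ _ hA]
    refine ⟨_, mk_mem_linearSet_graph.2 ⟨τ.symm (y / A), by simp [hA, hy], rfl⟩, ?_⟩
    rw [Projectivization.map_mk]
    congr 1
    rw [hφa, e, hyA]

/-- The semilinear map sends (x, f x) to (u(τx), v(τx)) with u, v linear over F. A point of the
linear set of a graph never has first coordinate 0, so u is injective, hence bijective, and the
image is the graph of k = v ∘ u⁻¹. The map f' is f transported by τ. -/
theorem exists_map_of_semilinearEquivalent [FiniteDimensional F K] {f g : K →ₗ[F] K}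
    (h : SemilinearEquivalent (linearSet f.graph) (linearSet g.graph)) :
    ∃ τ : K ≃+* K, ∀ f' : K →ₗ[F] K, (∀ x, τ (f x) = f' (τ x)) →
      ∃ A B C D : K, A * D - B * C ≠ 0 ∧ ∃ k : K →ₗ[F] K, valueSet k = valueSet g ∧
        ∀ x, k (A * x + B * f' x) = C * x + D * f' x := by
  obtain ⟨ψ, ⟨τ, φ, hφ, hψ⟩, himg⟩ := h
  refine ⟨τ, fun f' hf' => ?_⟩
  obtain ⟨A, hA⟩ : ∃ A, A = (φ (1, 0)).1 := ⟨_, rfl⟩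
  obtain ⟨C, hC⟩ : ∃ C, C = (φ (1, 0)).2 := ⟨_, rfl⟩
  obtain ⟨B, hB⟩ : ∃ B, B = (φ (0, 1)).1 := ⟨_, rfl⟩
  obtain ⟨D, hD⟩ : ∃ D, D = (φ (0, 1)).2 := ⟨_, rfl⟩
  have hφa : ∀ x y, φ (x, y) = (A * τ x + B * τ y, C * τ x + D * τ y) := by
    intro x y
    have : ((x, y) : K × K) = x • (1, 0) + y • (0, 1) := by simp
    rw [this, map_add, φ.map_smulₛₗ, φ.map_smulₛₗ]
    ext
    · simp [hA, hB, mul_comm]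
    · simp [hC, hD, mul_comm]
  have hdet : A * D - B * C ≠ 0 := by
    intro h0
    have h1 : φ (τ.symm D, -τ.symm C) = 0 := by
      rw [hφa]
      ext
      · simp; linear_combination h0
      · simp; ring
    have h2 : φ (τ.symm B, -τ.symm A) = 0 := by
      rw [hφa]
      ext
      · simp; ring
      · simp; linear_combination -h0
    have h1 := hφ.injective (h1.trans (map_zero φ).symm)
    have h2 := hφ.injective (h2.trans (map_zero φ).symm)
    simp only [Prod.mk_eq_zero, neg_eq_zero, EmbeddingLike.map_eq_zero_iff] at h1 h2
    have h3 : φ (1, 0) = 0 := by rw [hφa, h1.2, h2.2]; simp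
    have := hφ.injective (h3.trans (map_zero φ).symm)
    simp at this
  refine ⟨A, B, C, D, hdet, ?_⟩
  let u : K →ₗ[F] K := LinearMap.mulLeft F A + LinearMap.mulLeft F B ∘ₗ f'
  let v : K →ₗ[F] K := LinearMap.mulLeft F C + LinearMap.mulLeft F D ∘ₗ f'
  have hu : ∀ x, u x = A * x + B * f' x := fun x => rfl
  have hv : ∀ x, v x = C * x + D * f' x := fun x => rfl
  have hφu : ∀ x, φ (x, f x) = (u (τ x), v (τ x)) := fun x => by rw [hφa, hf', hu, hv]
  have fwd : ∀ x, x ≠ 0 → ∃ y, y ≠ 0 ∧ ∃ c : K, c ≠ 0 ∧ u x = c * y ∧ v x = c * g y := by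
    intro x hx
    have hx' : τ.symm x ≠ 0 := by simpa using hx
    have hmem := himg ▸ Set.mem_image_of_mem ψ
      (mk_mem_linearSet_graph.2 ⟨τ.symm x, hx', rfl⟩ : _ ∈ linearSet f.graph)
    obtain ⟨y, hy, hyP⟩ := mk_mem_linearSet_graph.1 hmem
    rw [hψ, Projectivization.map_mk, Projectivization.mk_eq_mk_iff'] at hyP
    obtain ⟨c, hc⟩ := hyP
    rw [hφu, τ.apply_symm_apply] at hc
    simp only [Prod.smul_mk, smul_eq_mul, Prod.mk.injEq] at hc
    refine ⟨y, hy, c, ?_, hc.1.symm, hc.2.symm⟩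
    rintro rfl
    have h3 := hφu (τ.symm x)
    rw [τ.apply_symm_apply, ← hc.1, ← hc.2, zero_mul, zero_mul] at h3
    have := hφ.injective (h3.trans (map_zero φ).symm)
    exact hx' (Prod.ext_iff.1 this).1
  have bwd : ∀ y, y ≠ 0 → ∃ x, x ≠ 0 ∧ ∃ c : K, u x = c * y ∧ v x = c * g y := by
    intro y hy
    have hmem : Projectivization.mk K (y, g y) (fun h0 => hy (Prod.ext_iff.1 h0).1) ∈
        linearSet g.graph := mk_mem_linearSet_graph.2 ⟨y, hy, rfl⟩
    rw [← himg] at hmem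
    obtain ⟨P, hP, hPy⟩ := hmem
    obtain ⟨x, hx, rfl⟩ := mk_mem_linearSet_graph.1 hP
    rw [hψ, Projectivization.map_mk, Projectivization.mk_eq_mk_iff'] at hPy
    obtain ⟨c, hc⟩ := hPy
    rw [hφu] at hc
    simp only [Prod.smul_mk, smul_eq_mul, Prod.mk.injEq] at hc
    exact ⟨τ x, by simpa using hx, c, hc.1.symm, hc.2.symm⟩
  have hinj : Function.Injective u := by
    rw [← LinearMap.ker_eq_bot, LinearMap.ker_eq_bot']
    intro x hx
    by_contra hx0
    obtain ⟨y, hy, c, hc, h1, -⟩ := fwd x hx0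
    rw [hx] at h1
    exact mul_ne_zero hc hy h1.symm
  let e := LinearEquiv.ofInjectiveEndo u hinj
  have he : ∀ x, e x = u x := fun x => rfl
  have hk : ∀ x, (v ∘ₗ (e.symm : K →ₗ[F] K)) (u x) = v x := fun x => by
    rw [← he]; simp
  refine ⟨v ∘ₗ (e.symm : K →ₗ[F] K), ?_, fun x => by rw [← hu, hk, hv]⟩
  ext z
  constructor
  · rintro ⟨w, hw, hwz⟩
    obtain ⟨x, rfl⟩ := e.surjective w
    have hx : x ≠ 0 := by rintro rfl; simp at hw
    rw [he, hk] at hwz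
    obtain ⟨y, hy, c, hc, h1, h2⟩ := fwd x hx
    refine ⟨y, hy, mul_left_cancel₀ hc ?_⟩
    rw [← h2, hwz, h1]; ring
  · rintro ⟨y, hy, hyz⟩
    obtain ⟨x, hx, c, h1, h2⟩ := bwd y hy
    refine ⟨u x, fun h0 => hx (hinj (h0.trans (map_zero u).symm)), ?_⟩
    rw [hk, h2, hyz, h1]; ring

end Projective

/-! ### Classification of Lunardon-Polverino linear sets -/

/-! #### Powers in a finite field -/

theorem pow_natCard_sub_one_eq_one {K : Type*} [Field K] [Finite K] {x : K} (hx : x ≠ 0) :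
    x ^ (Nat.card K - 1) = 1 := by
  have := Fintype.ofFinite K
  rw [Nat.card_eq_fintype_card, FiniteField.pow_card_sub_one_eq_one x hx]

theorem exists_pow_eq_of_pow_eq_one {K : Type*} [Field K] [Finite K] {u : K} {a b : ℕ} (hab : a * b = Nat.card K - 1)
    (hu : u ^ a = 1) : ∃ y : K, y ≠ 0 ∧ y ^ b = u := by
  have := Fintype.ofFinite K
  have hK : 1 < Nat.card K := Finite.one_lt_card
  have ha : 0 < a := Nat.pos_of_ne_zero fun h => by
    rw [h, zero_mul] at hab
    omega
  have hu0 : u ≠ 0 := by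
    rintro rfl
    simp [ha.ne'] at hu
  obtain ⟨g, hg⟩ := IsCyclic.exists_generator (α := Kˣ)
  obtain ⟨i, hi⟩ := (Submonoid.mem_powers_iff _ _).1
    ((mem_powers_iff_mem_zpowers).2 (hg (Units.mk0 u hu0)))
  have h1 : g ^ (i * a) = 1 := by
    rw [pow_mul, hi]
    ext
    simpa using hu
  have h2 : orderOf g = a * b := by
    rw [orderOf_eq_card_of_forall_mem_zpowers hg, Nat.card_units, hab]
  have h3 := orderOf_dvd_of_pow_eq_one h1
  rw [h2, mul_comm i] at h3
  obtain ⟨j, rfl⟩ := Nat.dvd_of_mul_dvd_mul_left ha h3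
  refine ⟨(g ^ j : Kˣ), Units.ne_zero _, ?_⟩
  have := congrArg Units.val hi
  rw [mul_comm, pow_mul] at this
  simpa using this

section FrobeniusPower

variable (F K : Type*) [Field F] [Finite F] [Field K] [Algebra F K] [FiniteDimensional F K]

/-- The automorphism `x ↦ x ^ (q ^ s)`. -/
noncomputable def frobPow (s : ℕ) : Gal(K/F) :=
  letI := Fintype.ofFinite F
  FiniteField.frobeniusAlgEquivOfAlgebraic F K ^ s

theorem frobPow_apply (s : ℕ) (x : K) : frobPow F K s x = x ^ (Nat.card F ^ s) := by
  let _ := Fintype.ofFinite F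
  rw [frobPow, AlgEquiv.coe_pow, FiniteField.coe_frobeniusAlgEquivOfAlgebraic_iterate,
    Nat.card_eq_fintype_card]

theorem frobPow_mul (s t : ℕ) : frobPow F K s * frobPow F K t = frobPow F K (s + t) :=
  (pow_add _ _ _).symm

theorem frobPow_eq_pow (s : ℕ) : frobPow F K s = frobPow F K 1 ^ s := by
  rw [frobPow, frobPow, pow_one]

theorem orderOf_frobPow_one : orderOf (frobPow F K 1) = Module.finrank F K := by
  let _ := Fintype.ofFinite F
  have : Finite K := Module.finite_of_finite F
  rw [frobPow, pow_one, FiniteField.orderOf_frobeniusAlgEquivOfAlgebraic]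

variable {F K}

theorem orderOf_frobPow {s : ℕ} (hs : Nat.Coprime s (Module.finrank F K)) :
    orderOf (frobPow F K s) = Module.finrank F K := by
  rw [frobPow_eq_pow, Nat.Coprime.orderOf_pow, orderOf_frobPow_one]
  rw [orderOf_frobPow_one]
  exact hs.symm

theorem frobPow_injOn {s t : ℕ} (hs : s < Module.finrank F K) (ht : t < Module.finrank F K)
    (h : frobPow F K s = frobPow F K t) : s = t := by
  rw [frobPow_eq_pow, frobPow_eq_pow F K t] at h
  exact pow_injOn_Iio_orderOf (x := frobPow F K 1) (by rwa [Set.mem_Iio, orderOf_frobPow_one])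
    (by rwa [Set.mem_Iio, orderOf_frobPow_one]) h

theorem frobPow_sub {s : ℕ} (hs : s ≤ Module.finrank F K) :
    frobPow F K (Module.finrank F K - s) = (frobPow F K s)⁻¹ := by
  rw [eq_inv_iff_mul_eq_one, frobPow_mul, Nat.sub_add_cancel hs, frobPow_eq_pow,
    ← orderOf_frobPow_one F K, pow_orderOf_eq_one]

theorem lpMap_eq_galSum {s : ℕ} (hs : s ≤ Module.finrank F K) (δ : K) :
    lpMap F K s δ = galSum (binomialCoeff (frobPow F K s) 1 δ) := by
  ext x
  rw [galSum_binomialCoeff, ← frobPow_sub hs, frobPow_apply, frobPow_apply, lpMap_apply, one_mul]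

/-! #### The norm to the fixed field of the square of Frobenius -/

variable (F K) in
/-- The exponent of the norm of `K` over its subfield of `q ^ gcd (2, n)` elements. -/
noncomputable def normExp : ℕ :=
  (Nat.card K - 1) / (Nat.card F ^ Nat.gcd 2 (Module.finrank F K) - 1)

omit [Finite F] in
variable (F K) in
theorem normExp_mul :
    normExp F K * (Nat.card F ^ Nat.gcd 2 (Module.finrank F K) - 1) = Nat.card K - 1 := by
  rw [normExp, Module.natCard_eq_pow_finrank (K := F) (V := K)]
  exact Nat.div_mul_cancel (Nat.pow_sub_one_dvd_pow_sub_one _ (Nat.gcd_dvd_right _ _))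

variable (F K) in
theorem normExp_ne_zero : normExp F K ≠ 0 := by
  have : Finite K := Module.finite_of_finite F
  intro h
  have h1 := normExp_mul F K
  have h2 : 1 < Nat.card K := Finite.one_lt_card
  rw [h, zero_mul] at h1
  omega

variable (F K) in
/-- The norm of `K` over its subfield of `q ^ gcd (2, n)` elements, as a map to `K`. -/
noncomputable def subNorm : K →*₀ K := powMonoidWithZeroHom (normExp_ne_zero F K)

theorem subNorm_apply (x : K) : subNorm F K x = x ^ normExp F K := rfl

theorem subNorm_map (α : K ≃+* K) (x : K) : subNorm F K (α x) = α (subNorm F K x) := by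
  rw [subNorm_apply, subNorm_apply, map_pow]

theorem subNorm_map' (α : Gal(K/F)) (x : K) : subNorm F K (α x) = α (subNorm F K x) := by
  rw [subNorm_apply, subNorm_apply, map_pow]

theorem subNorm_pow_eq_one {x : K} (hx : x ≠ 0) :
    subNorm F K x ^ (Nat.card F ^ Nat.gcd 2 (Module.finrank F K) - 1) = 1 := by
  have : Finite K := Module.finite_of_finite F
  rw [subNorm_apply, ← pow_mul, normExp_mul, pow_natCard_sub_one_eq_one hx]

theorem subNorm_pow_card (x : K) :
    subNorm F K x ^ (Nat.card F ^ Nat.gcd 2 (Module.finrank F K)) = subNorm F K x := by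
  by_cases hx : x = 0
  · subst hx
    rw [map_zero, zero_pow (pow_ne_zero _ Nat.card_pos.ne')]
  · rw [← Nat.sub_add_cancel (Nat.one_le_pow _ (Nat.card F) Nat.card_pos), pow_succ,
      subNorm_pow_eq_one hx, one_mul]

theorem subNorm_pow_card_pow (x : K) (m : ℕ) :
    subNorm F K x ^ (Nat.card F ^ (Nat.gcd 2 (Module.finrank F K) * m)) = subNorm F K x := by
  induction m with
  | zero => simp
  | succ m ih => rw [mul_add, mul_one, pow_add, pow_mul, ih, subNorm_pow_card]

theorem subNorm_frobPow_frobPow (s : ℕ) (x : K) :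
    subNorm F K (frobPow F K s (frobPow F K s x)) = subNorm F K x := by
  rw [subNorm_map', subNorm_map', ← AlgEquiv.mul_apply, frobPow_mul, frobPow_apply, ← two_mul]
  obtain ⟨m, hm⟩ := Nat.gcd_dvd_left 2 (Module.finrank F K)
  nth_rewrite 1 [hm]
  rw [mul_assoc, subNorm_pow_card_pow]

theorem algebraMap_norm_eq_subNorm_pow (x : K) : algebraMap F K (Algebra.norm F x) =
    subNorm F K x ^ ((Nat.card F ^ Nat.gcd 2 (Module.finrank F K) - 1) / (Nat.card F - 1)) := by
  have : Finite K := Module.finite_of_finite F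
  have hd : Nat.card F - 1 ∣ Nat.card F ^ Nat.gcd 2 (Module.finrank F K) - 1 :=
    Nat.sub_one_dvd_pow_sub_one _ _
  rw [FiniteField.algebraMap_norm_eq_pow, subNorm_apply, ← pow_mul, ← Nat.mul_div_assoc _ hd,
    normExp_mul]

theorem gcd_two_eq (n : ℕ) : (Odd n ∧ Nat.gcd 2 n = 1) ∨ (Even n ∧ Nat.gcd 2 n = 2) := by
  rcases Nat.even_or_odd n with h | h
  · exact Or.inr ⟨h, Nat.gcd_eq_left h.two_dvd⟩
  · exact Or.inl ⟨h, (Nat.coprime_two_left.2 h)⟩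

/-- For n odd `subNorm` is the norm itself. For n even, s is odd, so x ↦ x^(q^s) acts on the
subfield of q² elements as y ↦ y^q, and the product is y^(q+1) = N(x). -/
theorem subNorm_mul_subNorm_frobPow {s : ℕ} (hs : Nat.Coprime s (Module.finrank F K)) {x : K}
    (hx : Algebra.norm F x = 1) : subNorm F K x * subNorm F K (frobPow F K s x) = 1 := by
  have hq : 0 < Nat.card F - 1 := by
    have : 1 < Nat.card F := Finite.one_lt_card
    omega
  have h := algebraMap_norm_eq_subNorm_pow (F := F) x
  rw [hx, map_one] at h
  rw [subNorm_map', frobPow_apply]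
  rcases gcd_two_eq (Module.finrank F K) with ⟨-, hg⟩ | ⟨hn, hg⟩
  · rw [hg, pow_one, Nat.div_self hq, pow_one] at h
    rw [← h, one_pow, one_mul]
  · have hsodd : Odd s := by
      rw [← Nat.coprime_two_right]
      exact hs.coprime_dvd_right hn.two_dvd
    obtain ⟨m, rfl⟩ := hsodd
    have h2 := subNorm_pow_card_pow (F := F) x m
    rw [hg] at h2
    rw [pow_succ, pow_mul, h2]
    have h3 : (Nat.card F ^ 2 - 1) / (Nat.card F - 1) = Nat.card F + 1 := by
      refine Nat.div_eq_of_eq_mul_left hq ?_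
      have := Nat.sq_sub_sq (Nat.card F) 1
      simpa using this
    rw [hg, h3, pow_succ'] at h
    exact h.symm

/-- For n = 4 the exponent is q² + 1, and −1 is fixed by the q²-power map, so the result is
(−1)(−1). -/
theorem subNorm_neg_one (hn : Module.finrank F K = 4) : subNorm F K (-1) = 1 := by
  have hq : 1 < Nat.card F := Finite.one_lt_card
  have hM : normExp F K = Nat.card F ^ 2 + 1 := by
    rw [normExp, Module.natCard_eq_pow_finrank (K := F) (V := K), hn]
    have hq2 : 1 < Nat.card F ^ 2 := Nat.one_lt_pow (by norm_num) hq
    refine Nat.div_eq_of_eq_mul_left (by simpa using hq2) ?_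
    have := Nat.sq_sub_sq (Nat.card F ^ 2) 1
    simpa [← pow_mul] using this
  rw [subNorm_apply, hM, pow_succ, ← frobPow_apply]
  simp

/-- A form of Hilbert 90 for σ². With g = gcd(2, n), u is a (q^g − 1)-th power, and gcd(q^(2s) − 1,
q^n − 1) = q^g − 1, so by Bézout u = B^(q^(2s)−1) = σ²(B)/B for some B; take A = σ(B). -/
theorem exists_frobPow_div_eq {s : ℕ} (hs : Nat.Coprime s (Module.finrank F K)) {u : K}
    (hu : subNorm F K u = 1) : ∃ A : K, A ≠ 0 ∧ frobPow F K s A = u * (frobPow F K s)⁻¹ A := by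
  have : Finite K := Module.finite_of_finite F
  obtain ⟨y, hy, rfl⟩ := exists_pow_eq_of_pow_eq_one (normExp_mul F K) hu
  set a := Nat.card F ^ (s + s) - 1 with ha
  have hgcd : Nat.gcd a (Nat.card K - 1) =
      Nat.card F ^ Nat.gcd 2 (Module.finrank F K) - 1 := by
    rw [ha, Module.natCard_eq_pow_finrank (K := F) (V := K), Nat.pow_sub_one_gcd_pow_sub_one,
      ← two_mul, Nat.Coprime.gcd_mul_right_cancel _ hs]
  lift y to Kˣ using hy.isUnit
  obtain ⟨B, hB, hBa⟩ : ∃ B : Kˣ, (B : K) ≠ 0 ∧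
      (B : K) ^ a = (y : K) ^ (Nat.card F ^ Nat.gcd 2 (Module.finrank F K) - 1) := by
    refine ⟨y ^ Nat.gcdA a (Nat.card K - 1), Units.ne_zero _, ?_⟩
    rw [← hgcd, ← Units.val_pow_eq_pow_val, ← Units.val_pow_eq_pow_val]
    congr 1
    have h1 : y ^ (Nat.card K - 1) = 1 := by
      ext
      simpa using pow_natCard_sub_one_eq_one hy
    have h2 := Nat.gcd_eq_gcd_ab a (Nat.card K - 1)
    rw [← zpow_natCast, ← zpow_natCast, h2, zpow_add, zpow_mul _ ((Nat.card K - 1 : ℕ) : ℤ),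
      zpow_natCast _ (Nat.card K - 1), h1, one_zpow, mul_one, ← zpow_mul, mul_comm]
  refine ⟨frobPow F K s B, (map_ne_zero _).2 hB, ?_⟩
  rw [← AlgEquiv.mul_apply _ _ (B : K), ← AlgEquiv.mul_apply _ _ (B : K), inv_mul_cancel,
    frobPow_mul, frobPow_apply, AlgEquiv.one_apply, ← hBa, ← pow_succ, ha,
    Nat.sub_add_cancel (Nat.one_le_pow _ _ Nat.card_pos)]

end FrobeniusPower

/-! ### Equivalences between Lunardon-Polverino sets and their invariants. -/

section Classification

variable {F K : Type*} [Field F] [Finite F] [Field K] [Algebra F K] [FiniteDimensional F K]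

/-- Equality up to field automorphisms and inversion. -/
def AutInvRel {K : Type*} [Field K] (x y : K) : Prop := ∃ α : K ≃+* K, y = α x ∨ y * α x = 1

theorem norm_ringEquiv_eq_one {α : K ≃+* K} {x : K} (h : Algebra.norm F (α x) = 1) :
    Algebra.norm F x = 1 := by
  have : Finite K := Module.finite_of_finite F
  have h1 := FiniteField.algebraMap_norm_eq_pow (K := F) (x := α x)
  rw [h, map_one, ← map_pow, ← FiniteField.algebraMap_norm_eq_pow] at h1
  apply (algebraMap F K).injective
  apply α.injective
  rw [← h1, map_one, map_one]

theorem map_galSum_binomialCoeff (α : K ≃+* K) (s : ℕ) (a b x : K) :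
    α (galSum (binomialCoeff (frobPow F K s) a b) x) =
      galSum (binomialCoeff (frobPow F K s) (α a) (α b)) (α x) := by
  have h1 : ∀ x, α (frobPow F K s x) = frobPow F K s (α x) := fun x => by
    rw [frobPow_apply, frobPow_apply, map_pow]
  have h2 : ∀ x, α ((frobPow F K s)⁻¹ x) = (frobPow F K s)⁻¹ (α x) := fun x => by
    apply (frobPow F K s).injective
    rw [← h1, ← AlgEquiv.mul_apply, ← AlgEquiv.mul_apply, mul_inv_cancel, AlgEquiv.one_apply,
      AlgEquiv.one_apply]
  rw [galSum_binomialCoeff, galSum_binomialCoeff, map_add, map_mul, map_mul, h1, h2]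

theorem semilinearEquivalent_lpMap_map {s : ℕ} (hs : s ≤ Module.finrank F K) (δ : K)
    (α : K ≃+* K) : SemilinearEquivalent (linearSet (lpMap F K s δ).graph)
      (linearSet (lpMap F K s (α δ)).graph) := by
  rw [lpMap_eq_galSum hs, lpMap_eq_galSum hs]
  refine semilinearEquivalent_of_diagonal α one_ne_zero one_ne_zero fun x => ?_
  rw [map_galSum_binomialCoeff, map_one, one_mul, one_mul]

theorem semilinearEquivalent_lpMap_of_subNorm_eq {s : ℕ} (hs : s ≤ Module.finrank F K)
    (hsn : Nat.Coprime s (Module.finrank F K)) {δ η : K} (hδ : δ ≠ 0)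
    (h : subNorm F K δ = subNorm F K η) :
    SemilinearEquivalent (linearSet (lpMap F K s δ).graph)
      (linearSet (lpMap F K s η).graph) := by
  rw [lpMap_eq_galSum hs, lpMap_eq_galSum hs]
  obtain ⟨A, hA, hAu⟩ := exists_frobPow_div_eq hsn (u := η / δ) (by
    rw [map_div₀, h, div_self]
    rw [← h]
    exact (map_ne_zero _).2 hδ)
  refine semilinearEquivalent_of_diagonal (RingEquiv.refl K) hA
    ((map_ne_zero (frobPow F K s)).2 hA) fun x => ?_
  rw [galSum_binomialCoeff, galSum_binomialCoeff]
  simp only [RingEquiv.refl_apply, map_mul]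
  have h1 : frobPow F K s A * δ = η * (frobPow F K s)⁻¹ A := by
    rw [hAu]; field_simp
  linear_combination (frobPow F K s)⁻¹ x * h1

theorem semilinearEquivalent_lpMap_sub {s : ℕ} (hs : s ≤ Module.finrank F K) {δ : K}
    (hδ : δ ≠ 0) : SemilinearEquivalent (linearSet (lpMap F K s δ).graph)
      (linearSet (lpMap F K (Module.finrank F K - s) δ⁻¹).graph) := by
  rw [lpMap_eq_galSum hs, lpMap_eq_galSum (Nat.sub_le _ _)]
  refine semilinearEquivalent_of_diagonal (RingEquiv.refl K) one_ne_zero (inv_ne_zero hδ)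
    fun x => ?_
  rw [galSum_binomialCoeff, galSum_binomialCoeff, frobPow_sub hs, inv_inv]
  simp only [RingEquiv.refl_apply, one_mul]
  field_simp
  ring

/-- The adjoint of σ + δσ⁻¹ is σ(δ)σ + σ⁻¹; its Dickson matrix is the transpose, so the linear sets
coincide. Dividing by σ(δ) restores the leading coefficient 1. This is the source of the inversion
in `AutInvRel`. -/
theorem semilinearEquivalent_lpMap_adjoint {s : ℕ} (hs : s ≤ Module.finrank F K)
    (hsn : Nat.Coprime s (Module.finrank F K)) (hn : 3 ≤ Module.finrank F K) {δ : K}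
    (hδ : δ ≠ 0) (hδ1 : Algebra.norm F δ ≠ 1) :
    SemilinearEquivalent (linearSet (lpMap F K s δ).graph)
      (linearSet (lpMap F K s (frobPow F K s δ)⁻¹).graph) := by
  have : Finite K := Module.finite_of_finite F
  rw [lpMap_eq_galSum hs, lpMap_eq_galSum hs]
  set σ := frobPow F K s with hσdef
  have hσ : orderOf σ = Module.finrank F K := orderOf_frobPow hsn
  have hinv := ne_inv_of_orderOf hσ hn
  have hd : dickson (binomialCoeff σ (σ δ) 1) = (dickson (binomialCoeff σ 1 δ)).transpose := by
    ext α β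
    rw [Matrix.transpose_apply, dickson_apply, dickson_apply]
    have h1 : β⁻¹ * α = (α⁻¹ * β)⁻¹ := by group
    have h2 : β = α * (α⁻¹ * β) := by group
    rw [h1]
    nth_rewrite 2 [h2]
    rw [AlgEquiv.mul_apply]
    congr 1
    generalize α⁻¹ * β = γ
    by_cases g1 : γ = σ
    · rw [g1, binomialCoeff_self hinv, binomialCoeff_inv hinv]
    by_cases g2 : γ = σ⁻¹
    · rw [g2, binomialCoeff_inv hinv, inv_inv, binomialCoeff_self hinv, map_one]
    rw [binomialCoeff_of_ne g1 g2, binomialCoeff_of_ne, map_zero]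
    · exact fun h => g2 (inv_eq_iff_eq_inv.1 h)
    · exact fun h => g1 (inv_injective h)
  have hv := valueSet_eq_of_dickson_transpose
    (isScattered_binomial hσ (a := 1) (b := δ) (by simpa using hδ1.symm))
    (isScattered_binomial hσ (a := σ δ) (b := 1) (by rw [norm_algEquiv_apply]; simpa using hδ1)) hd
  rw [linearSet_graph_eq_of_valueSet_eq hv]
  have hσδ : σ δ ≠ 0 := (map_ne_zero σ).2 hδ
  refine semilinearEquivalent_of_diagonal (RingEquiv.refl K) one_ne_zero (inv_ne_zero hσδ)
    fun x => ?_
  rw [galSum_binomialCoeff, galSum_binomialCoeff]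
  simp only [RingEquiv.refl_apply, one_mul]
  field_simp

theorem semilinearEquivalent_lpMap_of_rel {s t : ℕ} (hs : s ≤ Module.finrank F K)
    (hsn : Nat.Coprime s (Module.finrank F K))
    (hn : 3 ≤ Module.finrank F K) {δ η : K} (hδ : δ ≠ 0) (hη : η ≠ 0)
    (hδ1 : Algebra.norm F δ ≠ 1) (hst : t = s ∨ s + t = Module.finrank F K)
    (h : AutInvRel (subNorm F K δ) (subNorm F K η)) :
    SemilinearEquivalent (linearSet (lpMap F K s δ).graph)
      (linearSet (lpMap F K t η).graph) := by
  have same : ∀ η : K, AutInvRel (subNorm F K δ) (subNorm F K η) →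
      SemilinearEquivalent (linearSet (lpMap F K s δ).graph)
        (linearSet (lpMap F K s η).graph) := by
    rintro η ⟨α, h | h⟩
    · refine (semilinearEquivalent_lpMap_map hs δ α).trans
        (semilinearEquivalent_lpMap_of_subNorm_eq hs hsn (by simpa using hδ) ?_)
      rw [subNorm_map, h]
    · refine ((semilinearEquivalent_lpMap_adjoint hs hsn hn hδ hδ1).trans
        (semilinearEquivalent_lpMap_map hs _ ((frobPow F K s)⁻¹.toRingEquiv.trans α))).trans
        (semilinearEquivalent_lpMap_of_subNorm_eq hs hsn (by simpa using hδ) ?_)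
      rw [eq_comm, ← subNorm_map, ← map_mul] at h
      have e : ((frobPow F K s)⁻¹.toRingEquiv.trans α) (frobPow F K s δ)⁻¹ = (α δ)⁻¹ := by
        rw [map_inv₀]
        congr 1
        change α ((frobPow F K s)⁻¹ (frobPow F K s δ)) = α δ
        rw [← AlgEquiv.mul_apply, inv_mul_cancel, AlgEquiv.one_apply]
      rw [e, map_inv₀, inv_eq_of_mul_eq_one_right]
      rw [mul_comm, ← map_mul, h]
  rcases hst with rfl | hst
  · exact same η h
  · have ht : t = Module.finrank F K - s := by omega
    have h' : AutInvRel (subNorm F K δ) (subNorm F K η⁻¹) := by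
      obtain ⟨α, h⟩ := h
      refine ⟨α, ?_⟩
      have hη' : subNorm F K η ≠ 0 := (map_ne_zero _).2 hη
      rw [map_inv₀]
      rcases h with h | h
      · right
        rw [← h, inv_mul_cancel₀ hη']
      · left
        exact inv_eq_of_mul_eq_one_right h
    have := semilinearEquivalent_lpMap_sub hs (inv_ne_zero hη)
    rw [inv_inv, ← ht] at this
    exact (same _ h').trans this

theorem rel_of_semilinearEquivalent_lpMap {s t : ℕ} (hs : s < Module.finrank F K)
    (hsn : Nat.Coprime s (Module.finrank F K)) (ht : t < Module.finrank F K)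
    (htn : Nat.Coprime t (Module.finrank F K)) (hn : 4 ≤ Module.finrank F K) {δ η : K}
    (hδ : δ ≠ 0) (hη : η ≠ 0) (hδ1 : Algebra.norm F δ ≠ 1) (hη1 : Algebra.norm F η ≠ 1)
    (h : SemilinearEquivalent (linearSet (lpMap F K s δ).graph)
      (linearSet (lpMap F K t η).graph)) :
    (t = s ∨ s + t = Module.finrank F K) ∧ AutInvRel (subNorm F K δ) (subNorm F K η) := by
  have : Finite K := Module.finite_of_finite F
  obtain ⟨α, hα⟩ := exists_map_of_semilinearEquivalent h
  obtain ⟨A, B, C, D, hdet, k, hk, hkx⟩ := hα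
    (galSum (binomialCoeff (frobPow F K s) 1 (α δ))) fun x => by
      rw [lpMap_eq_galSum hs.le, map_galSum_binomialCoeff, map_one]
  rw [lpMap_eq_galSum ht.le] at hk
  have hσ : orderOf (frobPow F K t) = Module.finrank F K := orderOf_frobPow htn
  have hρ : orderOf (frobPow F K s) = Module.finrank F K := orderOf_frobPow hsn
  obtain ⟨c, rfl⟩ := galSum_surjective k
  obtain ⟨a, b, rfl, hab, hnorm⟩ := coeff_of_valueSet_eq_binomial hσ rfl hn hη hη1 hk
  have hση : frobPow F K t η ≠ 0 := (map_ne_zero _).2 hη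
  have ha : a ≠ 0 := fun h0 => hση (by rw [← hab, h0, zero_mul])
  have hb : b ≠ 0 := fun h0 => hση (by rw [← hab, h0, map_zero, mul_zero])
  have hαδ : α δ ≠ 0 := by simpa using hδ
  have hmaps : MapsGraph (frobPow F K t) (frobPow F K s) a b 1 (α δ) A B C D := fun x => by
    simpa only [galSum_binomialCoeff] using hkx x
  have hNαδ : Algebra.norm F (1 : K) ≠ Algebra.norm F (α δ) := fun h0 => hδ1
    (norm_ringEquiv_eq_one (α := α) (by rw [← h0, map_one]))
  have hν := subNorm_frobPow_frobPow (F := F) (K := K) t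
  have hν1 := subNorm_neg_one (F := F) (K := K)
  have hN : ∀ x, Algebra.norm F x = 1 → _ := fun x => subNorm_mul_subNorm_frobPow (x := x) htn
  let σ' : K ≃+* K := (frobPow F K t).toRingEquiv
  have hσ' : ∀ x, frobPow F K t x = σ' x := fun x => rfl
  rcases hmaps.eq_or_five hσ hρ rfl hn ha one_ne_zero hαδ hdet with e | e | ⟨h5, e | e⟩
  · have hts := frobPow_injOn hs ht e
    refine ⟨Or.inl hts.symm, ?_⟩
    rw [e] at hmaps
    have hrel := hmaps.exists_relation hσ hn ha hb one_ne_zero hdet hab hnorm (subNorm F K)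
      hν hν1 hN
    simp only [map_one, mul_one, hσ', subNorm_map] at hrel
    rcases hrel with h | h | h | h
    · exact ⟨α, Or.inl h.symm⟩
    · exact ⟨α.trans σ', Or.inr h.symm⟩
    · refine ⟨α.trans σ'.symm, Or.inr ?_⟩
      have := congrArg σ'.symm h
      simpa using this.symm
    · exact ⟨α, Or.inl (σ'.injective h.symm)⟩
  · rw [← frobPow_sub ht.le] at e
    have h1 : 0 < t := Nat.pos_of_ne_zero fun h0 => by
      rw [h0, Nat.coprime_zero_left] at htn; omega
    have hts := frobPow_injOn hs (by omega) e
    refine ⟨Or.inr (by omega), ?_⟩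
    have hmaps := hmaps.swap
    rw [e, frobPow_sub ht.le, inv_inv] at hmaps
    have hrel := hmaps.exists_relation hσ hn ha hb hαδ hdet hab hnorm (subNorm F K)
      hν hν1 hN
    simp only [map_one, mul_one, hσ', subNorm_map] at hrel
    rcases hrel with h | h | h | h
    · exact ⟨α, Or.inr h.symm⟩
    · exact ⟨α.trans σ', Or.inl h.symm⟩
    · refine ⟨α.trans σ'.symm, Or.inl ?_⟩
      have := congrArg σ'.symm h
      simpa using this.symm
    · refine ⟨α, Or.inr (σ'.injective ?_)⟩
      rw [map_mul, map_one, ← h]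
  -- The exceptional exponents for n = 5 would give 1 and αδ equal norms, against N(δ) ≠ 1.
  · rw [e] at hmaps
    exact absurd (hmaps.norm_eq_of_five (hσ.trans h5) h5 ha hb hdet) hNαδ
  · have hmaps := hmaps.swap
    rw [e, inv_inv] at hmaps
    exact absurd (hmaps.norm_eq_of_five (hσ.trans h5) h5 ha hb hdet) hNαδ.symm

end Classification

/-! ### Counting equivalence classes -/

theorem Nat.card_quotient_eq_of_map {X Y : Type*} {r : Setoid X} {r' : Setoid Y} (f : X → Y)
    (h : ∀ x y, r x y ↔ r' (f x) (f y)) (hs : ∀ y, ∃ x, r' (f x) y) :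
    Nat.card (Quotient r) = Nat.card (Quotient r') := by
  refine Nat.card_eq_of_bijective (Quotient.map f fun x y hxy => (h x y).1 hxy) ⟨?_, ?_⟩
  · rintro ⟨x⟩ ⟨y⟩ hxy
    exact Quotient.sound ((h x y).2 (Quotient.exact hxy))
  · rintro ⟨y⟩
    obtain ⟨x, hx⟩ := hs y
    exact ⟨Quotient.mk _ x, Quotient.sound hx⟩

/-- The summands over one class add up to 1. -/
theorem Nat.card_quotient_eq_sum_inv {X : Type*} [Fintype X] (r : Setoid X) :
    (Nat.card (Quotient r) : ℚ) = ∑ x, ((Nat.card {y // r x y} : ℚ))⁻¹ := by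
  classical
  have := Fintype.ofFinite (Quotient r)
  rw [← Finset.sum_fiberwise Finset.univ (fun x => Quotient.mk r x)]
  have : ∀ q : Quotient r, ∑ x with Quotient.mk r x = q, ((Nat.card {y // r x y} : ℚ))⁻¹ = 1 := by
    intro q
    induction q using Quotient.inductionOn with
    | h a =>
    have hcard : ∀ x ∈ Finset.univ.filter (fun x => Quotient.mk r x = Quotient.mk r a),
        (Nat.card {y // r x y} : ℚ)⁻¹ =
          ((Finset.univ.filter (fun x => Quotient.mk r x = Quotient.mk r a)).card : ℚ)⁻¹ := by
      intro x hx
      have hx : r x a := Quotient.exact (Finset.mem_filter.1 hx).2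
      congr 2
      rw [Nat.card_eq_fintype_card, Fintype.card_subtype]
      congr 1
      ext y
      simp only [Finset.mem_filter, Finset.mem_univ, true_and]
      exact ⟨fun h => Quotient.sound (r.trans (r.symm h) hx),
        fun h => r.trans hx (r.symm (Quotient.exact h))⟩
    rw [Finset.sum_congr rfl hcard, Finset.sum_const, nsmul_eq_mul, mul_inv_cancel₀]
    have : a ∈ Finset.univ.filter (fun x => Quotient.mk r x = Quotient.mk r a) := by simp
    exact_mod_cast (Finset.card_pos.2 ⟨a, this⟩).ne'
  rw [Finset.sum_congr rfl fun q _ => this q]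
  simp [Nat.card_eq_fintype_card]

/-! #### Degrees of elements over the prime field -/

section Degree

variable (p : ℕ) [Fact p.Prime] {K : Type*} [Field K] [CharP K p]

/-- The degree of `x` over the prime field: the least `d > 0` with `x ^ p ^ d = x`. -/
noncomputable def frobDegree (x : K) : ℕ := Function.minimalPeriod (frobenius K p) x

theorem iterate_frobenius_apply (i : ℕ) (x : K) : (frobenius K p)^[i] x = x ^ p ^ i := by
  rw [iterate_frobenius]

theorem pow_pow_eq_self_iff (i : ℕ) (x : K) : x ^ p ^ i = x ↔ frobDegree p x ∣ i := by
  rw [frobDegree, ← Function.isPeriodicPt_iff_minimalPeriod_dvd, Function.IsPeriodicPt,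
    Function.IsFixedPt, iterate_frobenius_apply]

theorem frobDegree_map {E : Type*} [Field E] [CharP E p] (f : E →+* K) (x : E) :
    frobDegree p (f x) = frobDegree p x := by
  refine Nat.dvd_antisymm ?_ ?_
  · rw [← pow_pow_eq_self_iff, ← map_pow, (pow_pow_eq_self_iff p _ x).2 dvd_rfl]
  · rw [← pow_pow_eq_self_iff]
    apply f.injective
    rw [map_pow, (pow_pow_eq_self_iff p _ (f x)).2 dvd_rfl]

theorem pow_pow_eq_of_modEq {i j : ℕ} {x : K} (h : i ≡ j [MOD frobDegree p x]) :
    x ^ p ^ i = x ^ p ^ j := by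
  rw [← iterate_frobenius_apply, ← iterate_frobenius_apply,
    ← Function.iterate_mod_minimalPeriod_eq (n := i),
    ← Function.iterate_mod_minimalPeriod_eq (n := j)]
  exact congrArg (fun m => (frobenius K p)^[m] x) h

theorem frobDegree_pos [Finite K] (x : K) : 0 < frobDegree p x := by
  obtain ⟨n, hn⟩ : ∃ n : ℕ, 0 < n ∧ x ^ p ^ n = x := by
    obtain ⟨i, j, hij, h⟩ := Finite.exists_ne_map_eq_of_infinite fun i : ℕ => x ^ p ^ i
    wlog hlt : i < j generalizing i j
    · exact this j i hij.symm h.symm (by omega)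
    refine ⟨j - i, by omega, iterateFrobenius_inj K p i ?_⟩
    rw [iterateFrobenius_def, iterateFrobenius_def, ← pow_mul, ← pow_add,
      Nat.sub_add_cancel hlt.le]
    exact h.symm
  exact Nat.pos_of_dvd_of_pos ((pow_pow_eq_self_iff p n x).1 hn.2) hn.1

theorem frobDegree_eq_one_of_sq_eq_one [Finite K] {x : K} (h : x * x = 1) :
    frobDegree p x = 1 := by
  rw [← Nat.dvd_one, ← pow_pow_eq_self_iff, pow_one]
  rcases mul_self_eq_one_iff.1 h with rfl | rfl
  · rw [one_pow]
  · rw [← frobenius_def, map_neg, map_one]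

/-- The elements whose inverse is conjugate to them over the prime field. -/
def InverseConjugate (x : K) : Prop := ∃ i : ℕ, x * x ^ p ^ i = 1

theorem inverseConjugate_iff_exists_lt [Finite K] (x : K) :
    InverseConjugate p x ↔ ∃ i < frobDegree p x, x ^ (p ^ i + 1) = 1 := by
  constructor
  · rintro ⟨i, hi⟩
    refine ⟨i % frobDegree p x, Nat.mod_lt _ (frobDegree_pos p x), ?_⟩
    rw [pow_succ', pow_pow_eq_of_modEq p (Nat.mod_modEq i _), hi]
  · rintro ⟨i, -, hi⟩
    exact ⟨i, by rw [← pow_succ', hi]⟩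

/-- If the degree of `x` divides `2 * r` but not `r`, then the inverse of `x` is conjugate to `x`
only if it is equal to `x ^ p ^ r`. -/
theorem InverseConjugate.mul_pow_eq_one [Finite K] {x : K} (h : InverseConjugate p x) {r : ℕ}
    (h2 : frobDegree p x ∣ 2 * r) (hr : ¬ frobDegree p x ∣ r) : x * x ^ p ^ r = 1 := by
  obtain ⟨i, hi⟩ := h
  have hx0 : x ≠ 0 := by rintro rfl; simp at hi
  have hi2 : frobDegree p x ∣ 2 * i := by
    rw [← pow_pow_eq_self_iff, two_mul, pow_add, pow_mul]
    have h1 : x ^ p ^ i = x⁻¹ := eq_inv_of_mul_eq_one_right hi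
    rw [h1, inv_pow, h1, inv_inv]
  have hi1 : ¬ frobDegree p x ∣ i := by
    intro h
    rw [(pow_pow_eq_self_iff p i x).2 h] at hi
    rw [frobDegree_eq_one_of_sq_eq_one p hi] at hr
    exact hr (one_dvd _)
  rw [pow_pow_eq_of_modEq p (j := i) ?_, hi]
  generalize frobDegree p x = d at *
  -- Such a `j` is an odd multiple of d/2, so any two of them are congruent modulo d.
  have key : ∀ j, d ∣ 2 * j → ¬ d ∣ j → ∃ b c, d = 2 * c ∧ j = (2 * b + 1) * c := by
    rintro j ⟨a, ha⟩ hj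
    rcases Nat.even_or_odd' a with ⟨b, rfl | rfl⟩
    · exact absurd ⟨b, by linarith⟩ hj
    · have hd : Even d := by
        have : Even (d * (2 * b + 1)) := ha ▸ even_two_mul j
        rcases Nat.even_mul.1 this with h | h
        · exact h
        · exact absurd h (by simp)
      obtain ⟨c, hc⟩ := hd.two_dvd
      refine ⟨b, c, hc, ?_⟩
      rw [hc] at ha
      linarith
  obtain ⟨b, c, hc, hb⟩ := key r h2 hr
  obtain ⟨b', c', hc', hb'⟩ := key i hi2 hi1
  obtain rfl : c = c' := by omega
  have e : ∀ b, (2 * b + 1) * c = d * b + c := fun b => by rw [hc]; ring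
  rw [hb, hb', e, e]
  exact ((Nat.modEq_zero_iff_dvd.2 (dvd_mul_right d b)).trans
    (Nat.modEq_zero_iff_dvd.2 (dvd_mul_right d b')).symm).add_right c

theorem exists_ringEquiv_iff [Finite K] (x : K) (P : K → Prop) :
    (∃ α : K ≃+* K, P (α x)) ↔ ∃ i : ℕ, P (x ^ p ^ i) := by
  constructor
  · rintro ⟨α, hα⟩
    let _ := ZMod.algebra K p
    have hc : ∀ a, α (algebraMap (ZMod p) K a) = algebraMap (ZMod p) K a := fun a =>
      RingHom.congr_fun (Subsingleton.elim ((α : K →+* K).comp (algebraMap (ZMod p) K))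
        (algebraMap (ZMod p) K)) a
    obtain ⟨i, hi⟩ := FiniteField.exists_forall_apply_eq_pow (ZMod p) p K
      (AlgEquiv.ofRingEquiv hc)
    refine ⟨i, ?_⟩
    have := hi x
    rw [Nat.card_zmod] at this
    rw [← this]
    exact hα
  · rintro ⟨i, hi⟩
    exact ⟨iterateFrobeniusEquiv K p i, by rwa [iterateFrobeniusEquiv_apply, iterateFrobenius_def]⟩

theorem autInvRel_iff [Finite K] {x y : K} :
    AutInvRel x y ↔ ∃ i : ℕ, y = x ^ p ^ i ∨ y * x ^ p ^ i = 1 :=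
  exists_ringEquiv_iff p x fun z => y = z ∨ y * z = 1

theorem ncard_conjugates [Finite K] (x : K) :
    {y : K | ∃ i : ℕ, y = x ^ p ^ i}.ncard = frobDegree p x := by
  have h : {y : K | ∃ i : ℕ, y = x ^ p ^ i} =
      (fun i => x ^ p ^ i) '' (Finset.range (frobDegree p x) : Set ℕ) := by
    ext y
    constructor
    · rintro ⟨i, rfl⟩
      exact ⟨i % frobDegree p x, by simpa using Nat.mod_lt _ (frobDegree_pos p x),
        pow_pow_eq_of_modEq p (Nat.mod_modEq i _)⟩
    · rintro ⟨i, -, rfl⟩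
      exact ⟨i, rfl⟩
  rw [h, Set.InjOn.ncard_image, Set.ncard_coe_finset, Finset.card_range]
  intro i hi j hj hij
  simp only [← iterate_frobenius_apply] at hij
  exact (Function.iterate_injOn_Iio_minimalPeriod (f := frobenius K p) (x := x))
    (Finset.mem_range.1 hi) (Finset.mem_range.1 hj) hij

/-- The class is the union of the Frobenius orbit of x and the set of its inverses; these coincide
or are disjoint according to whether x⁻¹ is conjugate to x. -/
theorem ncard_autInvRel [Finite K] {x : K} (hx : x ≠ 0) [Decidable (InverseConjugate p x)] :
    {y : K | AutInvRel x y}.ncard =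
      if InverseConjugate p x then frobDegree p x else 2 * frobDegree p x := by
  have hinv : ∀ (y : K) (i : ℕ), y * x ^ p ^ i = 1 ↔ y⁻¹ = x ^ p ^ i := fun y i => by
    have : x ^ p ^ i ≠ 0 := pow_ne_zero _ hx
    rw [mul_eq_one_iff_eq_inv₀ this, inv_eq_iff_eq_inv]
  split_ifs with h
  · rw [← ncard_conjugates p x]
    congr 1
    ext y
    rw [Set.mem_ofPred_eq, autInvRel_iff p, Set.mem_ofPred_eq]
    refine ⟨?_, fun ⟨i, hi⟩ => ⟨i, Or.inl hi⟩⟩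
    rintro ⟨i, hi | hi⟩
    · exact ⟨i, hi⟩
    · obtain ⟨j, hj⟩ := h
      refine ⟨j + i, ?_⟩
      have hj' : x ^ p ^ j = x⁻¹ := eq_inv_of_mul_eq_one_right hj
      rw [pow_add, pow_mul, hj', inv_pow]
      exact eq_inv_of_mul_eq_one_left hi
  · have hU : {y : K | AutInvRel x y} = {y : K | ∃ i : ℕ, y = x ^ p ^ i} ∪
        Inv.inv '' {y : K | ∃ i : ℕ, y = x ^ p ^ i} := by
      ext y
      rw [Set.mem_ofPred_eq, autInvRel_iff p, Set.mem_union, Set.mem_ofPred_eq, exists_or]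
      refine or_congr Iff.rfl ?_
      constructor
      · rintro ⟨i, hi⟩
        exact ⟨y⁻¹, ⟨i, (hinv y i).1 hi⟩, inv_inv y⟩
      · rintro ⟨_, ⟨i, rfl⟩, rfl⟩
        exact ⟨i, inv_mul_cancel₀ (pow_ne_zero _ hx)⟩
    rw [hU, Set.ncard_union_eq, Set.ncard_image_of_injective _ inv_injective, ncard_conjugates,
      two_mul]
    rw [Set.disjoint_left]
    rintro _ ⟨i, rfl⟩ ⟨_, ⟨j, rfl⟩, hij⟩
    apply h
    obtain ⟨m, hm⟩ : ∃ m, i + m ≡ 0 [MOD frobDegree p x] := by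
      have hd := frobDegree_pos p x
      refine ⟨(frobDegree p x - 1) * i, Nat.modEq_zero_iff_dvd.2 ⟨i, ?_⟩⟩
      obtain ⟨d, hd⟩ : ∃ d, frobDegree p x = d + 1 := ⟨frobDegree p x - 1, by omega⟩
      rw [hd]
      simp
      ring
    refine ⟨j + m, ?_⟩
    have h1 : x ^ p ^ i * x ^ p ^ j = 1 := by
      rw [← hij]; exact inv_mul_cancel₀ (pow_ne_zero _ hx)
    have h2 : (x ^ p ^ i * x ^ p ^ j) ^ p ^ m = 1 ^ p ^ m := by rw [h1]
    have e : ∀ i, (x ^ p ^ i) ^ p ^ m = x ^ p ^ (i + m) := fun i => by rw [← pow_mul, ← pow_add]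
    rw [mul_pow, one_pow, e, e, pow_pow_eq_of_modEq p hm, pow_zero, pow_one] at h2
    exact h2

end Degree

/-! ### The sets F(d) and K(d) as sets of elements of given degree in a larger field. -/

section GaloisFieldDegrees

variable (p : ℕ) [Fact p.Prime]

theorem ncard_pow_eq_self_le {K : Type*} [Field K] {m : ℕ} (hm : 1 < m) :
    {x : K | x ^ m = x}.Finite ∧ {x : K | x ^ m = x}.ncard ≤ m := by
  classical
  have h : {x : K | x ^ m = x} =
      ((Polynomial.X ^ m - Polynomial.X : Polynomial K).roots.toFinset : Set K) := by
    ext x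
    rw [Finset.mem_coe, Multiset.mem_toFinset,
      Polynomial.mem_roots (FiniteField.X_pow_card_sub_X_ne_zero K hm)]
    simp [sub_eq_zero]
  rw [h]
  refine ⟨Finset.finite_toSet _, ?_⟩
  rw [Set.ncard_coe_finset]
  refine (Multiset.toFinset_card_le _).trans ((Polynomial.card_roots' _).trans ?_)
  rw [FiniteField.X_pow_card_sub_X_natDegree_eq K hm]

theorem pow_natCard_subfield {E : Type*} [Field E] [Finite E] (S : Subfield E) {x : E}
    (hx : x ∈ S) : x ^ Nat.card S = x := by
  have := Fintype.ofFinite S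
  have := FiniteField.pow_card (⟨x, hx⟩ : S)
  rw [Nat.card_eq_fintype_card]
  exact congrArg Subtype.val this

/-- The elements fixed by the Frobenius power of exponent `frobDegree p x` form a subfield
containing x, with at most p to that exponent elements. Conversely, a subfield of p^k elements
containing x has k divisible by the degree of x. -/
theorem mem_setF_iff {d : ℕ} (hd : d ≠ 0) (x : GaloisField p d) :
    x ∈ setF p d ↔ frobDegree p x = d := by
  have : Finite (GaloisField p d) := inferInstance
  have hcard := GaloisField.card p d hd
  have hp1 : 1 < p := (Fact.out : p.Prime).one_lt
  have hall : ∀ y : GaloisField p d, y ^ p ^ d = y := fun y => by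
    have := Fintype.ofFinite (GaloisField p d)
    rw [← hcard, Nat.card_eq_fintype_card, FiniteField.pow_card]
  constructor
  · intro hx
    let S : Subfield (GaloisField p d) :=
      ((iterateFrobenius (GaloisField p d) p (frobDegree p x)).eqLocusField (RingHom.id _))
    have hS : ∀ y, y ∈ S ↔ y ^ p ^ frobDegree p x = y := fun y => by
      simp only [S, RingHom.mem_eqLocusField, iterateFrobenius_def, RingHom.id_apply]
    have hST := hx S ((hS x).2 ((pow_pow_eq_self_iff p _ x).2 dvd_rfl))
    have huniv : {y : GaloisField p d | y ^ p ^ frobDegree p x = y} = Set.univ := by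
      ext y
      rw [Set.mem_ofPred_eq, ← hS, hST]
      simp
    have hle := (ncard_pow_eq_self_le (K := GaloisField p d)
      (Nat.one_lt_pow (frobDegree_pos p x).ne' hp1)).2
    rw [huniv, Set.ncard_univ, hcard] at hle
    exact Nat.dvd_antisymm ((pow_pow_eq_self_iff p d x).1 (hall x)) (by
      have h1 := (Nat.pow_le_pow_iff_right hp1).1 hle
      have h2 := Nat.le_of_dvd (Nat.pos_of_ne_zero hd) ((pow_pow_eq_self_iff p d x).1 (hall x))
      rw [le_antisymm h2 h1])
  · intro hx S hxS
    have : CharP S p := inferInstance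
    have := Fintype.ofFinite S
    obtain ⟨k, -, hk⟩ := FiniteField.card S p
    have h1 := pow_natCard_subfield S hxS
    rw [Nat.card_eq_fintype_card, hk, pow_pow_eq_self_iff, hx] at h1
    have h2 : Nat.card (GaloisField p d) ≤ Nat.card S := by
      rw [hcard, Nat.card_eq_fintype_card, hk]
      exact Nat.pow_le_pow_right hp1.le (Nat.le_of_dvd k.pos h1)
    have h3 : (S : Set (GaloisField p d)) = Set.univ :=
      Set.eq_of_subset_of_ncard_le (Set.subset_univ _) (by
        rw [Set.ncard_univ]; exact h2)
    exact SetLike.coe_injective (h3.trans Subfield.coe_top.symm)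

theorem mem_setK_iff {d : ℕ} (hd : d ≠ 0) (x : GaloisField p d) :
    x ∈ setK p d ↔ frobDegree p x = d ∧ InverseConjugate p x := by
  have : Finite (GaloisField p d) := inferInstance
  rw [setK, Set.mem_ofPred_eq, mem_setF_iff p hd, inverseConjugate_iff_exists_lt]
  exact and_congr_right fun h => by rw [h]

theorem range_galoisField_hom {K : Type*} [Field K] {d : ℕ} (hd0 : d ≠ 0)
    (f : GaloisField p d →+* K) : Set.range f = {x : K | x ^ p ^ d = x} := by
  have : Finite (GaloisField p d) := inferInstance
  have hcard := GaloisField.card p d hd0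
  have h := ncard_pow_eq_self_le (K := K) (Nat.one_lt_pow hd0 (Fact.out : p.Prime).one_lt)
  refine Set.eq_of_subset_of_ncard_le ?_ ?_ h.1
  · rintro _ ⟨y, rfl⟩
    have := Fintype.ofFinite (GaloisField p d)
    rw [Set.mem_ofPred_eq, ← map_pow, ← hcard, Nat.card_eq_fintype_card, FiniteField.pow_card]
  · rw [← Set.image_univ, Set.ncard_image_of_injective _ f.injective, Set.ncard_univ, hcard]
    exact h.2

variable {K : Type*} [Field K] [CharP K p] [Finite K] {N : ℕ} (hK : Nat.card K = p ^ N)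
include hK

theorem exists_galoisField_hom {d : ℕ} (hd : d ∣ N) (hd0 : d ≠ 0) :
    Nonempty (GaloisField p d →+* K) := by
  let _ := ZMod.algebra K p
  have hN : Module.finrank (ZMod p) K = N := by
    have := FiniteField.pow_finrank_eq_natCard p K
    rw [hK] at this
    exact Nat.pow_right_injective (Fact.out : p.Prime).two_le this
  have : Module.finrank (ZMod p) (GaloisField p d) ∣ Module.finrank (ZMod p) K := by
    rwa [GaloisField.finrank p hd0, hN]
  obtain ⟨f⟩ := FiniteField.nonempty_algHom_of_finrank_dvd this
  exact ⟨f⟩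

theorem ncard_pow_pow_eq_self {d : ℕ} (hd : d ∣ N) (hd0 : d ≠ 0) :
    {x : K | x ^ p ^ d = x}.ncard = p ^ d := by
  obtain ⟨f⟩ := exists_galoisField_hom p hK hd hd0
  rw [← range_galoisField_hom p hd0 f, ← Set.image_univ,
    Set.ncard_image_of_injective _ f.injective, Set.ncard_univ, GaloisField.card p d hd0]

theorem ncard_setF {d : ℕ} (hd : d ∣ N) (hd0 : d ≠ 0) :
    (setF p d).ncard = {x : K | frobDegree p x = d}.ncard := by
  obtain ⟨f⟩ := exists_galoisField_hom p hK hd hd0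
  rw [← Set.ncard_image_of_injective _ f.injective]
  congr 1
  ext x
  constructor
  · rintro ⟨y, hy, rfl⟩
    rw [Set.mem_ofPred_eq, frobDegree_map, (mem_setF_iff p hd0 y).1 hy]
  · intro hx
    have hx : frobDegree p x = d := hx
    have : x ∈ Set.range f := by
      rw [range_galoisField_hom p hd0 f, Set.mem_ofPred_eq, pow_pow_eq_self_iff, hx]
    obtain ⟨y, rfl⟩ := this
    exact ⟨y, (mem_setF_iff p hd0 y).2 ((frobDegree_map p f y).symm.trans hx), rfl⟩

theorem ncard_setK {d : ℕ} (hd : d ∣ N) (hd0 : d ≠ 0) :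
    (setK p d).ncard = {x : K | frobDegree p x = d ∧ InverseConjugate p x}.ncard := by
  obtain ⟨f⟩ := exists_galoisField_hom p hK hd hd0
  rw [← Set.ncard_image_of_injective _ f.injective]
  congr 1
  have hic : ∀ y, InverseConjugate p (f y) ↔ InverseConjugate p y := fun y =>
    exists_congr fun i => by rw [← map_pow, ← map_mul, map_eq_one_iff f f.injective]
  ext x
  constructor
  · rintro ⟨y, hy, rfl⟩
    rw [Set.mem_ofPred_eq, frobDegree_map, hic]
    exact (mem_setK_iff p hd0 y).1 hy
  · rintro ⟨hx, hx2⟩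
    have : x ∈ Set.range f := by
      rw [range_galoisField_hom p hd0 f, Set.mem_ofPred_eq, pow_pow_eq_self_iff, hx]
    obtain ⟨y, rfl⟩ := this
    exact ⟨y, (mem_setK_iff p hd0 y).2 ⟨(frobDegree_map p f y).symm.trans hx, (hic y).1 hx2⟩, rfl⟩

end GaloisFieldDegrees

/-! ### Sums of reciprocal class sizes, grouped by degree. -/

section ClassSum

variable (p : ℕ) [Fact p.Prime] {K : Type*} [Field K] [CharP K p]

theorem frobDegree_eq_one_iff (x : K) : frobDegree p x = 1 ↔ x ^ p = x := by
  rw [← Nat.dvd_one, ← pow_pow_eq_self_iff, pow_one]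

theorem inverseConjugate_iff_of_degree_one {x : K} (hx : frobDegree p x = 1) :
    InverseConjugate p x ↔ x * x = 1 := by
  have h : ∀ i, x ^ p ^ i = x := fun i => (pow_pow_eq_self_iff p i x).2 (hx ▸ one_dvd i)
  simp [InverseConjugate, h]

omit [Fact p.Prime] in
theorem one_ne_neg_one_of_char_ne_two (hp : p ≠ 2) : (1 : K) ≠ -1 := by
  have : ringChar K ≠ 2 := by rwa [ringChar.eq K p]
  exact (Ring.neg_one_ne_one_of_char_ne_two this).symm

variable [Finite K]

/-- An element of degree d has weight 1/(2d), doubled when its inverse is conjugate to it; hence the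
sum of two cardinalities. -/
theorem sum_inv_ncard_autInvRel (A : Finset K) (hA0 : ∀ x ∈ A, x ≠ 0) {D : ℕ} (hD : D ≠ 0)
    (hA : ∀ x ∈ A, frobDegree p x ∣ D) :
    ∑ x ∈ A, ({y : K | AutInvRel x y}.ncard : ℚ)⁻¹ = ∑ d ∈ D.divisors,
      (({x : K | frobDegree p x = d ∧ x ∈ A}.ncard : ℚ) +
        ({x : K | (frobDegree p x = d ∧ InverseConjugate p x) ∧ x ∈ A}.ncard : ℚ)) /
          (2 * (d : ℚ)) := by
  classical
  rw [← Finset.sum_fiberwise_of_maps_to (g := frobDegree p) (t := D.divisors)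
    (fun x hx => Nat.mem_divisors.2 ⟨hA x hx, hD⟩)]
  refine Finset.sum_congr rfl fun d hd => ?_
  have hd0 : (d : ℚ) ≠ 0 := by
    exact_mod_cast (Nat.pos_of_mem_divisors hd).ne'
  have e1 : {x : K | frobDegree p x = d ∧ x ∈ A} =
      ((A.filter fun x => frobDegree p x = d : Finset K) : Set K) := by
    ext x; simp [and_comm]
  have e2 : {x : K | (frobDegree p x = d ∧ InverseConjugate p x) ∧ x ∈ A} =
      (((A.filter fun x => frobDegree p x = d).filter fun x => InverseConjugate p x : Finset K) :
        Set K) := by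
    ext x; simp; tauto
  rw [e1, e2, Set.ncard_coe_finset, Set.ncard_coe_finset]
  set B := A.filter fun x => frobDegree p x = d with hB
  have hw : ∀ x ∈ B, ({y : K | AutInvRel x y}.ncard : ℚ)⁻¹ =
      1 / (2 * d) + if InverseConjugate p x then 1 / (2 * (d : ℚ)) else 0 := by
    intro x hx
    obtain ⟨hxA, hxd⟩ := Finset.mem_filter.1 hx
    rw [ncard_autInvRel p (hA0 x hxA), hxd]
    split_ifs
    · field_simp; norm_num
    · push_cast; field_simp; norm_num
  rw [Finset.sum_congr rfl hw, Finset.sum_add_distrib, ← Finset.sum_filter, Finset.sum_const,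
    Finset.sum_const, nsmul_eq_mul, nsmul_eq_mul]
  field_simp

variable {N : ℕ} (hK : Nat.card K = p ^ N)
include hK

/-- The case n odd. Excluding 0 and 1 affects only degree one, where p − 2 elements remain; if p ≠
2, just −1 among them is its own inverse, giving ((p − 2) + 1)/2. -/
theorem sum_inv_ncard_autInvRel_odd {r : ℕ} (hr : r ≠ 0) (hrN : r ∣ N) (A : Finset K)
    (hA : ∀ x, x ∈ A ↔ x ≠ 0 ∧ x ^ p ^ r = x ∧ x ≠ 1) :
    ∑ x ∈ A, ({y : K | AutInvRel x y}.ncard : ℚ)⁻¹ =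
      (∑ d ∈ r.divisors with 1 < d,
        (((setF p d).ncard : ℚ) + ((setK p d).ncard : ℚ)) / (2 * (d : ℚ))) +
      (if p = 2 then 0 else ((p : ℚ) - 1) / 2) := by
  have hp2 := (Fact.out : p.Prime).two_le
  rw [sum_inv_ncard_autInvRel p A (fun x hx => ((hA x).1 hx).1) hr
    (fun x hx => (pow_pow_eq_self_iff p r x).1 ((hA x).1 hx).2.1),
    ← Finset.sum_filter_add_sum_filter_not r.divisors (1 < ·)]
  congr 1
  · refine Finset.sum_congr rfl fun d hd => ?_
    obtain ⟨hdr, hd1⟩ := Finset.mem_filter.1 hd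
    have hdr := Nat.dvd_of_mem_divisors hdr
    have hmem : ∀ x : K, frobDegree p x = d → x ∈ A := fun x hx => by
      refine (hA x).2 ⟨?_, (pow_pow_eq_self_iff p r x).2 (hx ▸ hdr), ?_⟩
      · rintro rfl
        have : frobDegree p (0 : K) = 1 := (frobDegree_eq_one_iff p _).2 (zero_pow (by omega))
        omega
      · rintro rfl
        have : frobDegree p (1 : K) = 1 := (frobDegree_eq_one_iff p _).2 (one_pow _)
        omega
    rw [ncard_setF p hK (hdr.trans hrN) (by omega), ncard_setK p hK (hdr.trans hrN) (by omega)]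
    have e1 : {x : K | frobDegree p x = d ∧ x ∈ A} = {x : K | frobDegree p x = d} := by
      ext x; exact and_iff_left_of_imp (hmem x)
    have e2 : {x : K | (frobDegree p x = d ∧ InverseConjugate p x) ∧ x ∈ A} =
        {x : K | frobDegree p x = d ∧ InverseConjugate p x} := by
      ext x; exact and_iff_left_of_imp fun h => hmem x h.1
    rw [e1, e2]
  · have h1 : r.divisors.filter (fun d => ¬ 1 < d) = {1} := by
      ext d
      simp only [Finset.mem_filter, Nat.mem_divisors, Finset.mem_singleton]
      constructor
      · rintro ⟨⟨h, -⟩, h1⟩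
        have := Nat.pos_of_dvd_of_pos h (Nat.pos_of_ne_zero hr)
        omega
      · rintro rfl
        exact ⟨⟨one_dvd _, hr⟩, by omega⟩
    rw [h1, Finset.sum_singleton]
    have hF : {x : K | frobDegree p x = 1 ∧ x ∈ A} = {x : K | x ^ p ^ 1 = x} \ {0, 1} := by
      ext x
      simp only [Set.mem_ofPred_eq, Set.mem_sdiff, Set.mem_insert_iff, Set.mem_singleton_iff, not_or,
        pow_one, frobDegree_eq_one_iff, hA]
      refine and_congr_right fun h => ?_
      rw [and_iff_right (a := x ^ p ^ r = x)]
      rw [pow_pow_eq_self_iff, (frobDegree_eq_one_iff p x).2 h]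
      exact one_dvd _
    have hcF : ({x : K | frobDegree p x = 1 ∧ x ∈ A}.ncard : ℚ) = p - 2 := by
      rw [hF, Set.ncard_sdiff (by
        rintro x (rfl | rfl)
        · exact zero_pow (by simp; omega)
        · exact one_pow _), ncard_pow_pow_eq_self p hK (one_dvd _) one_ne_zero,
        Set.ncard_pair zero_ne_one, pow_one, Nat.cast_sub hp2]
      norm_num
    have hcK : ({x : K | (frobDegree p x = 1 ∧ InverseConjugate p x) ∧ x ∈ A}.ncard : ℚ) =
        if p = 2 then 0 else 1 := by
      split_ifs with hp
      · have : {x : K | (frobDegree p x = 1 ∧ InverseConjugate p x) ∧ x ∈ A} = ∅ := by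
          ext x
          simp only [Set.mem_ofPred_eq, Set.mem_empty_iff_false, iff_false]
          rintro ⟨⟨hd, hic⟩, hx⟩
          have h2 := (inverseConjugate_iff_of_degree_one p hd).1 hic
          have h3 := (frobDegree_eq_one_iff p x).1 hd
          rw [hp, pow_two, h2] at h3
          exact ((hA x).1 hx).2.2 h3.symm
        rw [this]
        simp
      · have : {x : K | (frobDegree p x = 1 ∧ InverseConjugate p x) ∧ x ∈ A} = {-1} := by
          ext x
          simp only [Set.mem_ofPred_eq, Set.mem_singleton_iff]
          constructor
          · rintro ⟨⟨hd, hic⟩, hx⟩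
            exact (mul_self_eq_one_iff.1
              ((inverseConjugate_iff_of_degree_one p hd).1 hic)).resolve_left ((hA x).1 hx).2.2
          · rintro rfl
            have hd : frobDegree p (-1 : K) = 1 := frobDegree_eq_one_of_sq_eq_one p (by ring)
            refine ⟨⟨hd, (inverseConjugate_iff_of_degree_one p hd).2 (by ring)⟩, (hA _).2
              ⟨by simp, (pow_pow_eq_self_iff p r _).2 (hd ▸ one_dvd r),
                (one_ne_neg_one_of_char_ne_two p hp).symm⟩⟩
        rw [this, Set.ncard_singleton]
        simp
    rw [hcF, hcK]
    split_ifs with hp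
    · subst hp; norm_num
    · push_cast; ring

/-- The case n even. If the degree divides r, then x^(p^r) = x and the last condition reads x² ≠ 1,
which matters only in degree one: there 0, 1, −1 are excluded. If the degree does not divide r, the
condition excludes exactly the elements conjugate to their inverse, so |F(d)| − |K(d)| elements
remain, all of weight 1/(2d). -/
theorem sum_inv_ncard_autInvRel_even {r : ℕ} (hr : r ≠ 0) (hrN : 2 * r ∣ N) (A : Finset K)
    (hA : ∀ x, x ∈ A ↔ x ≠ 0 ∧ x ^ p ^ (2 * r) = x ∧ x * x ^ p ^ r ≠ 1) :
    ∑ x ∈ A, ({y : K | AutInvRel x y}.ncard : ℚ)⁻¹ =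
      (∑ d ∈ r.divisors with 1 < d,
        (((setF p d).ncard : ℚ) + ((setK p d).ncard : ℚ)) / (2 * (d : ℚ))) +
      (∑ d ∈ (2 * r).divisors with ¬ d ∣ r,
          (((setF p d).ncard : ℚ) - ((setK p d).ncard : ℚ)) / (2 * (d : ℚ))) +
      (if p = 2 then 0 else ((p : ℚ) - 3) / 2) := by
  have hp2 := (Fact.out : p.Prime).two_le
  have h2r : 2 * r ≠ 0 := by omega
  have hdiv : (2 * r).divisors.filter (fun d => d ∣ r) = r.divisors := by
    ext d
    simp only [Finset.mem_filter, Nat.mem_divisors]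
    exact ⟨fun h => ⟨h.2, hr⟩, fun h => ⟨⟨h.1.mul_left 2, h2r⟩, h.1⟩⟩
  rw [sum_inv_ncard_autInvRel p A (fun x hx => ((hA x).1 hx).1) h2r
    (fun x hx => (pow_pow_eq_self_iff p _ x).1 ((hA x).1 hx).2.1),
    ← Finset.sum_filter_add_sum_filter_not (2 * r).divisors (· ∣ r), hdiv,
    ← Finset.sum_filter_add_sum_filter_not r.divisors (1 < ·), add_right_comm]
  congr 1
  · congr 1
    · refine Finset.sum_congr rfl fun d hd => ?_
      obtain ⟨hdr, hd1⟩ := Finset.mem_filter.1 hd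
      have hdr := Nat.dvd_of_mem_divisors hdr
      have hdN : d ∣ N := (hdr.mul_left 2).trans hrN
      have hmem : ∀ x : K, frobDegree p x = d → x ∈ A := fun x hx => by
        refine (hA x).2 ⟨?_, (pow_pow_eq_self_iff p _ x).2 (hx ▸ hdr.mul_left 2), ?_⟩
        · rintro rfl
          have : frobDegree p (0 : K) = 1 := (frobDegree_eq_one_iff p _).2 (zero_pow (by omega))
          omega
        · rw [(pow_pow_eq_self_iff p r x).2 (hx ▸ hdr)]
          intro h
          have := frobDegree_eq_one_of_sq_eq_one p h
          omega
      rw [ncard_setF p hK hdN (by omega), ncard_setK p hK hdN (by omega)]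
      have e1 : {x : K | frobDegree p x = d ∧ x ∈ A} = {x : K | frobDegree p x = d} := by
        ext x; exact and_iff_left_of_imp (hmem x)
      have e2 : {x : K | (frobDegree p x = d ∧ InverseConjugate p x) ∧ x ∈ A} =
          {x : K | frobDegree p x = d ∧ InverseConjugate p x} := by
        ext x; exact and_iff_left_of_imp fun h => hmem x h.1
      rw [e1, e2]
    · refine Finset.sum_congr rfl fun d hd => ?_
      obtain ⟨hdr, hd1⟩ := Finset.mem_filter.1 hd
      have hd0 : d ≠ 0 := (Nat.pos_of_mem_divisors hdr).ne'
      have hdr := Nat.dvd_of_mem_divisors hdr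
      have hdN : d ∣ N := hdr.trans hrN
      have hmem : ∀ x : K, frobDegree p x = d → (x ∈ A ↔ ¬ InverseConjugate p x) := fun x hx => by
        have hx0 : x ≠ 0 := by
          rintro rfl
          have : frobDegree p (0 : K) = 1 := (frobDegree_eq_one_iff p _).2 (zero_pow (by omega))
          rw [← hx, this] at hd1
          exact hd1 (one_dvd _)
        rw [hA, and_iff_right hx0,
          and_iff_right ((pow_pow_eq_self_iff p _ x).2 (hx ▸ hdr)), not_iff_not]
        exact ⟨fun h => ⟨r, h⟩, fun h => h.mul_pow_eq_one p (hx ▸ hdr) (hx ▸ hd1)⟩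
      rw [ncard_setF p hK hdN hd0, ncard_setK p hK hdN hd0]
      have e1 : {x : K | (frobDegree p x = d ∧ InverseConjugate p x) ∧ x ∈ A} = ∅ := by
        ext x
        simp only [Set.mem_ofPred_eq, Set.mem_empty_iff_false, iff_false]
        rintro ⟨⟨h1, h2⟩, h3⟩
        exact (hmem x h1).1 h3 h2
      have e2 : {x : K | frobDegree p x = d ∧ x ∈ A} = {x : K | frobDegree p x = d} \
          {x : K | frobDegree p x = d ∧ InverseConjugate p x} := by
        ext x
        simp only [Set.mem_ofPred_eq, Set.mem_sdiff, not_and]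
        exact and_congr_right fun h => by rw [hmem x h]; simp [h]
      have hsub : {x : K | frobDegree p x = d ∧ InverseConjugate p x} ⊆
          {x : K | frobDegree p x = d} := fun x hx => hx.1
      rw [e1, e2, Set.ncard_sdiff hsub, Nat.cast_sub (Set.ncard_le_ncard hsub)]
      simp
  · have h1 : r.divisors.filter (fun d => ¬ 1 < d) = {1} := by
      ext d
      simp only [Finset.mem_filter, Nat.mem_divisors, Finset.mem_singleton]
      constructor
      · rintro ⟨⟨h, -⟩, h1⟩
        have := Nat.pos_of_dvd_of_pos h (Nat.pos_of_ne_zero hr)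
        omega
      · rintro rfl
        exact ⟨⟨one_dvd _, hr⟩, by omega⟩
    rw [h1, Finset.sum_singleton]
    have hmem : ∀ x : K, frobDegree p x = 1 → (x ∈ A ↔ x ≠ 0 ∧ x * x ≠ 1) := fun x hx => by
      have h : ∀ i, x ^ p ^ i = x := fun i => (pow_pow_eq_self_iff p i x).2 (hx ▸ one_dvd i)
      simp [hA, h]
    have hF : {x : K | frobDegree p x = 1 ∧ x ∈ A} = {x : K | x ^ p ^ 1 = x} \ {0, 1, -1} := by
      ext x
      simp only [Set.mem_ofPred_eq, Set.mem_sdiff, Set.mem_insert_iff, Set.mem_singleton_iff, not_or,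
        pow_one, ← frobDegree_eq_one_iff]
      exact and_congr_right fun h => by rw [hmem x h, Ne, Ne, mul_self_eq_one_iff, not_or]
    have hK0 : {x : K | (frobDegree p x = 1 ∧ InverseConjugate p x) ∧ x ∈ A} = ∅ := by
      ext x
      simp only [Set.mem_ofPred_eq, Set.mem_empty_iff_false, iff_false]
      rintro ⟨⟨h1, h2⟩, h3⟩
      exact ((hmem x h1).1 h3).2 ((inverseConjugate_iff_of_degree_one p h1).1 h2)
    have hcF : {x : K | frobDegree p x = 1 ∧ x ∈ A}.ncard = p - ({0, 1, -1} : Set K).ncard := by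
      rw [hF, Set.ncard_sdiff (by
        rintro x (rfl | rfl | rfl)
        · exact zero_pow (by simp; omega)
        · exact one_pow _
        · rw [Set.mem_ofPred_eq, pow_one, ← frobenius_def, map_neg, map_one]),
        ncard_pow_pow_eq_self p hK ((one_dvd _)) one_ne_zero, pow_one]
    rw [hK0, hcF]
    split_ifs with hp
    · subst hp
      have : (-1 : K) = 1 := CharTwo.neg_eq 1
      rw [this, Set.pair_eq_singleton, Set.ncard_pair zero_ne_one]
      simp
    · have h3 : ({0, 1, -1} : Set K).ncard = 3 := by
        rw [Set.ncard_eq_three]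
        exact ⟨0, 1, -1, zero_ne_one, by simp, one_ne_neg_one_of_char_ne_two p hp, rfl⟩
      rw [h3, Nat.cast_sub (by omega)]
      simp

end ClassSum

/-! ### The number of classes of Lunardon-Polverino linear sets -/

theorem AutInvRel.refl {K : Type*} [Field K] (x : K) : AutInvRel x x :=
  ⟨RingEquiv.refl K, Or.inl rfl⟩

theorem AutInvRel.symm {K : Type*} [Field K] {x y : K} (h : AutInvRel x y) : AutInvRel y x := by
  obtain ⟨α, rfl | h⟩ := h
  · exact ⟨α.symm, Or.inl (α.symm_apply_apply x).symm⟩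
  · refine ⟨α.symm, Or.inr ?_⟩
    have := congrArg α.symm h
    rwa [map_mul, map_one, α.symm_apply_apply, mul_comm] at this

theorem AutInvRel.trans {K : Type*} [Field K] {x y z : K} (h : AutInvRel x y)
    (h' : AutInvRel y z) : AutInvRel x z := by
  obtain ⟨α, rfl | h⟩ := h
  · obtain ⟨β, h' | h'⟩ := h'
    · exact ⟨α.trans β, Or.inl h'⟩
    · exact ⟨α.trans β, Or.inr h'⟩
  · have hβ : ∀ β : K ≃+* K, β y * β (α x) = 1 := fun β => by rw [← map_mul, h, map_one]
    obtain ⟨β, rfl | h'⟩ := h'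
    · exact ⟨α.trans β, Or.inr (hβ β)⟩
    · refine ⟨α.trans β, Or.inl ?_⟩
      exact (eq_inv_of_mul_eq_one_left h').trans (inv_eq_of_mul_eq_one_right (hβ β))

section Counting

variable (F K : Type*) [Field F] [Finite F] [Field K] [Algebra F K] [FiniteDimensional F K]

/-- The values of `subNorm` at the coefficients allowed in a Lunardon-Polverino map. -/
def admissibleNorms : Set K := {y | ∃ δ : K, δ ≠ 0 ∧ Algebra.norm F δ ≠ 1 ∧ subNorm F K δ = y}

/-- The exponents allowed in a Lunardon-Polverino map. -/
noncomputable def admissibleExponents : Finset ℕ :=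
  (Finset.range (Module.finrank F K)).filter fun s => (Module.finrank F K).Coprime s

variable {F K}

theorem norm_eq_one_iff_subNorm_pow (x : K) : Algebra.norm F x = 1 ↔ subNorm F K x ^
    ((Nat.card F ^ Nat.gcd 2 (Module.finrank F K) - 1) / (Nat.card F - 1)) = 1 := by
  rw [← algebraMap_norm_eq_subNorm_pow, map_eq_one_iff _ (algebraMap F K).injective]

/-- The map `subNorm` takes all nonzero values in the subfield of q^gcd(2,n) elements, and the norm
of δ to F is a power of its `subNorm`. -/
theorem mem_admissibleNorms_iff (y : K) : y ∈ admissibleNorms F K ↔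
    y ≠ 0 ∧ y ^ (Nat.card F ^ Nat.gcd 2 (Module.finrank F K)) = y ∧
    y ^ ((Nat.card F ^ Nat.gcd 2 (Module.finrank F K) - 1) / (Nat.card F - 1)) ≠ 1 := by
  have : Finite K := Module.finite_of_finite F
  constructor
  · rintro ⟨δ, h0, h1, rfl⟩
    exact ⟨(map_ne_zero _).2 h0, subNorm_pow_card δ,
      fun h => h1 ((norm_eq_one_iff_subNorm_pow δ).2 h)⟩
  · rintro ⟨h0, h1, h2⟩
    have hpos : 0 < Nat.card F ^ Nat.gcd 2 (Module.finrank F K) := Nat.pow_pos Nat.card_pos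
    have h3 : y ^ (Nat.card F ^ Nat.gcd 2 (Module.finrank F K) - 1) = 1 := by
      refine mul_right_cancel₀ h0 ?_
      rw [← pow_succ, Nat.sub_add_cancel hpos, h1, one_mul]
    obtain ⟨δ, hδ, hδy⟩ := exists_pow_eq_of_pow_eq_one
      (by rw [mul_comm]; exact normExp_mul F K) h3
    have hδy : subNorm F K δ = y := hδy
    exact ⟨δ, hδ, fun h => h2 (hδy ▸ (norm_eq_one_iff_subNorm_pow δ).1 h), hδy⟩

theorem AutInvRel.mem_admissibleNorms {x y : K} (h : AutInvRel x y)
    (hx : x ∈ admissibleNorms F K) : y ∈ admissibleNorms F K := by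
  obtain ⟨δ, h0, h1, rfl⟩ := hx
  obtain ⟨α, rfl | h⟩ := h
  · exact ⟨α δ, by simpa using h0, fun h => h1 (norm_ringEquiv_eq_one h), subNorm_map α δ⟩
  · refine ⟨(α δ)⁻¹, by simpa using h0, fun h => h1 (norm_ringEquiv_eq_one (α := α) ?_), ?_⟩
    · have h2 := map_mul (Algebra.norm F) (α δ) (α δ)⁻¹
      rwa [mul_inv_cancel₀ (by simpa using h0), map_one, h, mul_one, eq_comm] at h2
    · rw [map_inv₀, subNorm_map, eq_comm]
      exact eq_inv_of_mul_eq_one_left h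

variable (F K) in
/-- The relation between the parameters of equivalent Lunardon-Polverino linear sets. -/
def parameterSetoid : Setoid (admissibleExponents F K × admissibleNorms F K) where
  r x y := ((y.1 : ℕ) = x.1 ∨ (x.1 + y.1 : ℕ) = Module.finrank F K) ∧ AutInvRel x.2.1 y.2.1
  iseqv :=
    { refl := fun x => ⟨Or.inl rfl, AutInvRel.refl _⟩
      symm := fun h => ⟨by have := h.1; omega, h.2.symm⟩
      trans := fun h h' => ⟨by have := h.1; have := h'.1; omega, h.2.trans h'.2⟩ }

/-- A linear set does not determine its parameters, but any choice of them will do: two choices for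
the same set are related by `rel_of_semilinearEquivalent_lpMap`, since a set is equivalent to
itself. -/
theorem numLP_eq_card_parameterSetoid (hn : 4 ≤ Module.finrank F K) :
    numLP F K = Nat.card (Quotient (parameterSetoid F K)) := by
  have hexp : ∀ s, s ∈ admissibleExponents F K ↔
      s < Module.finrank F K ∧ Nat.Coprime s (Module.finrank F K) := fun s => by
    rw [admissibleExponents, Finset.mem_filter, Finset.mem_range, Nat.coprime_comm]
  have h : ∀ L : {L : Set (ℙ K (K × K)) // IsLunardonPolverino F K L}, ∃ (s : ℕ) (δ : K),
      s ∈ admissibleExponents F K ∧ δ ≠ 0 ∧ Algebra.norm F δ ≠ 1 ∧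
        L.1 = linearSet (lpMap F K s δ).graph := by
    rintro ⟨L, s, δ, -, h2, h3, h4, h5, h6⟩
    exact ⟨s, δ, (hexp s).2 ⟨h2, h3⟩, h4, h5, h6⟩
  choose s δ hs hδ hδ1 hL using h
  refine Nat.card_quotient_eq_of_map
    (fun L => (⟨s L, hs L⟩, ⟨subNorm F K (δ L), δ L, hδ L, hδ1 L, rfl⟩)) ?_ ?_
  · intro L M
    obtain ⟨h1, h2⟩ := (hexp _).1 (hs L)
    obtain ⟨h3, h4⟩ := (hexp _).1 (hs M)
    have e : (lpSetoid F K) L M ↔ SemilinearEquivalent (linearSet (lpMap F K (s L) (δ L)).graph)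
        (linearSet (lpMap F K (s M) (δ M)).graph) := by
      rw [← hL, ← hL]; rfl
    rw [e]
    exact ⟨fun h => rel_of_semilinearEquivalent_lpMap h1 h2 h3 h4 hn (hδ L) (hδ M) (hδ1 L)
      (hδ1 M) h, fun h => semilinearEquivalent_lpMap_of_rel h1.le h2 (by omega) (hδ L) (hδ M)
      (hδ1 L) h.1 h.2⟩
  · rintro ⟨⟨t, ht⟩, ⟨_, η, hη, hη1, rfl⟩⟩
    obtain ⟨h1, h2⟩ := (hexp _).1 ht
    have h0 : 1 ≤ t := Nat.pos_of_ne_zero fun h0 => by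
      rw [h0, Nat.coprime_zero_left] at h2; omega
    let L : {L : Set (ℙ K (K × K)) // IsLunardonPolverino F K L} :=
      ⟨linearSet (lpMap F K t η).graph, t, η, h0, h1, h2, hη, hη1, rfl⟩
    obtain ⟨h3, h4⟩ := (hexp _).1 (hs L)
    refine ⟨L, rel_of_semilinearEquivalent_lpMap h3 h4 h1 h2 hn (hδ L) hη (hδ1 L) hη1 ?_⟩
    rw [← hL]
    exact SemilinearEquivalent.refl _

/-- A class of parameters is the product of {s, n − s}, which has two elements since s is coprime to
n ≥ 4, with a class of `AutInvRel`. -/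
theorem numLP_eq_sum (hn : 4 ≤ Module.finrank F K) (A : Finset K)
    (hA : ∀ x, x ∈ A ↔ x ∈ admissibleNorms F K) :
    (numLP F K : ℚ) = (∑ x ∈ A, ({y : K | AutInvRel x y}.ncard : ℚ)⁻¹) *
      (Nat.totient (Module.finrank F K) / 2) := by
  classical
  have : Finite K := Module.finite_of_finite F
  have := Fintype.ofFinite (admissibleNorms F K)
  have hclass : ∀ x : admissibleExponents F K × admissibleNorms F K,
      (Nat.card {y // parameterSetoid F K x y} : ℚ)⁻¹ =
        2⁻¹ * ({y : K | AutInvRel x.2.1 y}.ncard : ℚ)⁻¹ := by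
    rintro ⟨⟨s, hs⟩, ⟨x, hx⟩⟩
    obtain ⟨h1, h2⟩ := Finset.mem_filter.1 hs
    have h1 := Finset.mem_range.1 h1
    have hne : s ≠ Module.finrank F K - s := fun h => by
      have h3 : Module.finrank F K = s * 2 := by omega
      have h4 := Nat.Coprime.eq_one_of_dvd h2.symm ⟨2, h3⟩
      omega
    have h0 : 0 < s := Nat.pos_of_ne_zero fun h0 => by
      rw [h0, Nat.coprime_zero_right] at h2; omega
    have hs' : Module.finrank F K - s ∈ admissibleExponents F K :=
      Finset.mem_filter.2 ⟨Finset.mem_range.2 (by omega),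
        Nat.coprime_comm.1 ((Nat.coprime_self_sub_left h1.le).2 h2.symm)⟩
    let e : {y // parameterSetoid F K (⟨s, hs⟩, ⟨x, hx⟩) y} ≃
        ({s, Module.finrank F K - s} : Set ℕ) × {y : K | AutInvRel x y} :=
      { toFun := fun y => (⟨y.1.1.1, by
            have := y.2.1
            simp only [Set.mem_insert_iff, Set.mem_singleton_iff]
            simp only at this
            omega⟩, ⟨y.1.2.1, y.2.2⟩)
        invFun := fun z => ⟨(⟨z.1.1, by
            obtain ⟨⟨t, rfl | rfl⟩, _⟩ := z
            exacts [hs, hs']⟩, ⟨z.2.1, AutInvRel.mem_admissibleNorms z.2.2 hx⟩), by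
            obtain ⟨⟨t, rfl | rfl⟩, _⟩ := z
            exacts [Or.inl rfl, Or.inr (by simp only; omega)], z.2.2⟩
        left_inv := fun _ => rfl
        right_inv := fun _ => rfl }
    rw [Nat.card_congr e, Nat.card_prod, Nat.card_coe_set_eq, Nat.card_coe_set_eq,
      Set.ncard_pair hne]
    push_cast
    rw [mul_inv]
  rw [numLP_eq_card_parameterSetoid hn, Nat.card_quotient_eq_sum_inv,
    Finset.sum_congr rfl fun x _ => hclass x, Fintype.sum_prod_type]
  simp only [Finset.sum_const, Finset.card_univ, Fintype.card_coe, nsmul_eq_mul]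
  rw [← Finset.mul_sum, ← Finset.sum_subtype A hA fun x => ({y : K | AutInvRel x y}.ncard : ℚ)⁻¹,
    admissibleExponents, ← Nat.totient]
  ring

end Counting

theorem theorem4p2 (p r n : ℕ) [Fact p.Prime] (hn : 4 ≤ n) (hq : p ^ r ≠ 2)
    (F K : Type*) [Field F] [Finite F] [Field K] [Algebra F K]
    (hF : Nat.card F = p ^ r) (hK : Module.finrank F K = n) :
    (Odd n → (numLP F K : ℚ) =
      ((∑ d ∈ r.divisors with 1 < d,
          (((setF p d).ncard : ℚ) + ((setK p d).ncard : ℚ)) / (2 * (d : ℚ)))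
        + epsLP p n) * ((Nat.totient n : ℚ) / 2)) ∧
    (Even n → (numLP F K : ℚ) =
      ((∑ d ∈ r.divisors with 1 < d,
          (((setF p d).ncard : ℚ) + ((setK p d).ncard : ℚ)) / (2 * (d : ℚ)))
        + (∑ d ∈ (2 * r).divisors with ¬ d ∣ r,
          (((setF p d).ncard : ℚ) - ((setK p d).ncard : ℚ)) / (2 * (d : ℚ)))
        + epsLP p n) * ((Nat.totient n : ℚ) / 2)) := by
  subst hK
  have : FiniteDimensional F K := Module.finite_of_finrank_pos (by omega)
  have : Finite K := Module.finite_of_finite F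
  have hp := (Fact.out : p.Prime)
  have hF1 : 1 < Nat.card F := Finite.one_lt_card
  have hr : r ≠ 0 := by rintro rfl; simp [hF] at hF1
  have hcard : Nat.card K = p ^ (r * Module.finrank F K) := by
    rw [Module.natCard_eq_pow_finrank (K := F), hF, pow_mul]
  have : CharP K p := by
    have := Fintype.ofFinite K
    exact charP_of_card_eq_prime_pow (f := r * Module.finrank F K)
      (by rw [← Nat.card_eq_fintype_card, hcard])
  let A : Finset K := (Set.toFinite (admissibleNorms F K)).toFinset
  have hA : ∀ x, x ∈ A ↔ x ∈ admissibleNorms F K := fun x => Set.Finite.mem_toFinset _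
  rw [numLP_eq_sum hn A hA, epsLP]
  -- For n odd the admissible values are the y ≠ 0, 1 in 𝔽_q. For n even, (q² − 1)/(q − 1) = q + 1
  -- turns the norm condition into y · y^q ≠ 1 in 𝔽_{q²}.
  rcases gcd_two_eq (Module.finrank F K) with ⟨hodd, he⟩ | ⟨heven, he⟩
  · refine ⟨fun _ => ?_, fun h => absurd h (Nat.not_even_iff_odd.2 hodd)⟩
    rw [sum_inv_ncard_autInvRel_odd p hcard hr (dvd_mul_right _ _) A fun x => ?_, if_pos hodd]
    rw [hA, mem_admissibleNorms_iff, he, pow_one, hF, Nat.div_self (by omega), pow_one]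
  · refine ⟨fun h => absurd heven (Nat.not_even_iff_odd.2 h), fun _ => ?_⟩
    rw [sum_inv_ncard_autInvRel_even p hcard hr ?_ A fun x => ?_,
      if_neg (Nat.not_odd_iff_even.2 heven)]
    · rw [mul_comm]
      exact mul_dvd_mul_left r heven.two_dvd
    · have hdiv : (Nat.card F ^ 2 - 1) / (Nat.card F - 1) = Nat.card F + 1 := by
        refine Nat.div_eq_of_eq_mul_left (by omega) ?_
        rw [← Nat.sq_sub_sq, one_pow]
      rw [hA, mem_admissibleNorms_iff, he, hdiv, hF, ← pow_mul, mul_comm r 2, pow_succ']
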